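/- Let $a>b>0$ and $\lambda\in\mathbb R$, $p^2=a^2+b^2$, $r^2=a^2-b^2$. Let $\mathcal P^6\subset\mathbb R^9(\omega,\alpha,\beta)$ be given by $\alpha\cdot\alpha=a^2$, $\beta\cdot\beta=b^2$, $\alpha\cdot\beta=0$, and put $M=(2\omega_1,2\omega_2,\omega_3+\lambda)$. The Hamiltonian field of a function $F$ is given by the Lie–Poisson bracket: $\dot M=M\times F_M+\alpha\times F_\alpha+\beta\times F_\beta$, $\dot\alpha=\alpha\times F_M$, $\dot\beta=\beta\times F_M$. Consider the integrals in involution of the Kowalevski gyrostat in a double field $$H=\omega_1^2+\omega_2^2+\tfrac12\omega_3^2-\alpha_1-\beta_2,$$ $$K=(\omega_1^2-\omega_2^2+\alpha_1-\beta_2)^2+(2\omega_1\omega_2+\alpha_2+\beta_1)^2+2\lambda[(\omega_3-\lambda)(\omega_1^2+\omega_2^2)+2\omega_1\alpha_3+2\omega_2\beta_3],$$ $$G=\tfrac14[(M\cdot\alpha)^2+(M\cdot\beta)^2]+\tfrac12(\omega_3-\lambda)\,M\cdot(\alpha\times\beta)-b^2\alpha_1-a^2\beta_2,$$ and the integral map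 $J=(H,K,G):\mathcal P^6\to\mathbb R^3(h,k,g)$. The rank of a point is the rank of $dJ$ on $T\mathcal P^6$. If $x$ is a point of rank $2$ and $F$ is a linear combination of $H,K,G$ with $dF(x)=0$ on $T_x\mathcal P^6$, let $A_F$ be the linearization of the Hamiltonian field of $F$ on $T_x\mathcal P^6$; when its characteristic polynomial is $\mu^4(\mu^2-C_F)$, $C_F$ is called the squared characteristic exponent of $F$. The point $x$ is of type "center" if some such $F$ has $C_F<0$, of type "saddle" if some such $F$ has $C_F>0$, and degenerate if no such $F$ has $C_F\ne0$. Consider the surfaces with parameters $(s,h)$, $s\neq0$, $$\Pi_1:\ k=p^2+\left(h-\tfrac{\lambda^2}2\right)^2-4\left(h-\tfrac{\lambda^2}2\right)s+3s^2-\frac{p^4-r^4}{4s^2},\quad g=\left(h-\tfrac{\lambda^2}2-s\right)s^2+\frac{p^4-r^4}{4s};$$ $$\Pi_2:\ k=-2\lambda^2\left(h-\tfrac{\lambda^2}2-2s\right)-\lambda^4+\frac{r^4}{4s^2},\quad g=\tfrac12p^2\left(h+\tfrac{\lambda^2}2\right)-\lambda^2s^2-\frac{r^4}{4s}.$$ Put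 $x_{1,2}=(\alpha_1-\beta_2)\pm i(\alpha_2+\beta_1)$, $y_{1,2}=(\alpha_1+\beta_2)\pm i(\alpha_2-\beta_1)$, $z_{1,2}=\alpha_3\pm i\beta_3$, $w_{1,2}=\omega_1\pm i\omega_2$, $w_3=\omega_3$, $N=x_2z_1w_1+x_1z_2w_2+z_1z_2(w_3+\lambda)$, $D=w_1w_2(w_3-\lambda)$. The critical subsystem $\mathcal M_1$ is the closure of the set $\mathcal M_1^0$ of points of $\mathcal P^6$ at which $D\ne0$ and $$y_1=-\frac1D\{w_1(w_3-\lambda)[x_2w_1+z_2(w_3+\lambda)]+N\},\qquad y_2=-\frac1D\{w_2(w_3-\lambda)[x_1w_2+z_1(w_3+\lambda)]+N\}.$$ **Theorem.** Let $x\in\mathcal M_1$ be a critical point of $J$ of rank $2$, and let $h=H(x)$. The function $S_1=N/(2D)$ on $\mathcal M_1^0$ has a limit $s\in\mathbb R\setminus\{0\}$ at $x$, and $J(x)$ is the point of $\Pi_1$ with parameters $(s,h)$. Put $$\mu^2=\frac1{2s}\left[12s^4-8\left(h-\tfrac{\lambda^2}2\right)s^3+p^4-r^4\right]\left[2s^2-2\left(h+\tfrac{\lambda^2}2\right)s+p^2\right].$$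 Then $\mu^2$ is the squared characteristic exponent at $x$ of a linear combination of $H,K,G$ that is critical at $x$ and has coefficient $2$ at $G$. The point $x$ is of type "center" if and only if $\mu^2<0$, of type "saddle" if and only if $\mu^2>0$, and degenerate if and only if $\mu^2=0$. On $\Pi_1$, the set $\mu^2=0$ is the union of the cuspidal edge of $\Pi_1$ and the curve of tangency of $\Pi_1$ with $\Pi_2$; thus $x$ is degenerate if and only if $(s,h)$ belongs to this union. Here both curves are taken in the parameter plane $(s,h)$, $s\ne0$: the cuspidal edge consists of the points at which the section of $\Pi_1$ by the plane $h=\mathrm{const}$ has an ordinary (semicubical) cusp, and the tangency curve of the points at which $\Pi_1$ and $\Pi_2$ meet, are both regular, and have the same tangent plane; each curve is taken with its limit points. -/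

import Mathlib

open scoped Matrix Topology

noncomputable section

namespace KowalevskiGyrostat

/-- The space `ℝ⁹` of triples `(ω, α, β)`; the components `1, 2, 3` of a vector are indexed by
`0, 1, 2`. -/
abbrev State : Type := (Fin 3 → ℝ) × (Fin 3 → ℝ) × (Fin 3 → ℝ)

/-- Angular velocity. -/
def om (x : State) : Fin 3 → ℝ := x.1

/-- First force vector. -/
def al (x : State) : Fin 3 → ℝ := x.2.1

/-- Second force vector. -/
def be (x : State) : Fin 3 → ℝ := x.2.2

/-! ### Phase space -/

/-- The geometric integrals `(α·α, β·β, α·β)`. -/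
def geom (x : State) : ℝ × ℝ × ℝ := (al x ⬝ᵥ al x, be x ⬝ᵥ be x, al x ⬝ᵥ be x)

/-- The phase space `P⁶`. -/
def phaseSpace (a b : ℝ) : Set State := {x | geom x = (a ^ 2, b ^ 2, 0)}

/-- The tangent space at `x` of the level set of the geometric integrals through `x`. -/
def tangent (x : State) : Submodule ℝ State := LinearMap.ker (fderiv ℝ geom x : State →ₗ[ℝ] ℝ × ℝ × ℝ)

/-! ### First integrals -/

/-- The energy integral. -/
def H (x : State) : ℝ :=
  om x 0 ^ 2 + om x 1 ^ 2 + om x 2 ^ 2 / 2 - al x 0 - be x 1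

/-- The integral `K`. -/
def K (lam : ℝ) (x : State) : ℝ :=
  (om x 0 ^ 2 - om x 1 ^ 2 + al x 0 - be x 1) ^ 2
    + (2 * om x 0 * om x 1 + al x 1 + be x 0) ^ 2
    + 2 * lam * ((om x 2 - lam) * (om x 0 ^ 2 + om x 1 ^ 2)
        + 2 * om x 0 * al x 2 + 2 * om x 1 * be x 2)

/-- The kinetic momentum `(2ω₁, 2ω₂, ω₃ + λ)`. -/
def momentum (lam : ℝ) (x : State) : Fin 3 → ℝ := ![2 * om x 0, 2 * om x 1, om x 2 + lam]

/-- The integral `G`, with `M_α = M·α`, `M_β = M·β`, `M_γ = M·(α × β)`. -/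
def G (a b lam : ℝ) (x : State) : ℝ :=
  ((momentum lam x ⬝ᵥ al x) ^ 2 + (momentum lam x ⬝ᵥ be x) ^ 2) / 4
    + (om x 2 - lam) * (momentum lam x ⬝ᵥ (al x ⨯₃ be x)) / 2
    - b ^ 2 * al x 0 - a ^ 2 * be x 1

/-- The integral map `J = H × K × G`. -/
def J (a b lam : ℝ) (x : State) : ℝ × ℝ × ℝ := (H x, K lam x, G a b lam x)

/-- The rank at `x` of the restriction of `J` to the phase space. -/
def rank (a b lam : ℝ) (x : State) : ℕ :=
  Module.finrank ℝ ((tangent x).map (fderiv ℝ (J a b lam) x : State →ₗ[ℝ] ℝ × ℝ × ℝ))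

/-- The linear combination `cH H + cK K + cG G`. -/
def integral (a b lam cH cK cG : ℝ) (x : State) : ℝ :=
  cH * H x + cK * K lam x + cG * G a b lam x

/-! ### Hamiltonian fields

The Lie-Poisson bracket in the variables `(M, α, β)`, `M = (2ω₁, 2ω₂, ω₃ + λ)`, for which the
geometric integrals are Casimir functions: the field of `F` is
`M' = M × F_M + α × F_α + β × F_β`, `α' = α × F_M`, `β' = β × F_M`.
For `F = H` it is the Euler-Poisson system of the gyrostat. -/

/-- The gradient of `F` in `M`, expressed by the derivatives in `ω`. -/
def gradM (F : State → ℝ) (x : State) : Fin 3 → ℝ :=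
  ![fderiv ℝ F x (Pi.single 0 1, 0, 0) / 2, fderiv ℝ F x (Pi.single 1 1, 0, 0) / 2,
    fderiv ℝ F x (Pi.single 2 1, 0, 0)]

/-- The gradient of `F` in `α`. -/
def gradAl (F : State → ℝ) (x : State) : Fin 3 → ℝ :=
  fun i => fderiv ℝ F x (0, Pi.single i 1, 0)

/-- The gradient of `F` in `β`. -/
def gradBe (F : State → ℝ) (x : State) : Fin 3 → ℝ :=
  fun i => fderiv ℝ F x (0, 0, Pi.single i 1)

/-- `M'` along the Hamiltonian field of `F`. -/
def momentumRate (lam : ℝ) (F : State → ℝ) (x : State) : Fin 3 → ℝ :=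
  momentum lam x ⨯₃ gradM F x + al x ⨯₃ gradAl F x + be x ⨯₃ gradBe F x

/-- The Hamiltonian field of `F` in the coordinates `(ω, α, β)`. -/
def sgrad (lam : ℝ) (F : State → ℝ) (x : State) : State :=
  (![momentumRate lam F x 0 / 2, momentumRate lam F x 1 / 2, momentumRate lam F x 2],
    al x ⨯₃ gradM F x, be x ⨯₃ gradM F x)

/-! ### Types of critical points of rank 2 -/

/-- `dF = 0` at `x` on the phase space, and the linearization `A` of the Hamiltonian field of `F`
on the six-dimensional tangent space at `x` has characteristic polynomial `μ⁴ (μ² - c)`. -/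
def HasSquaredExponent (lam : ℝ) (F : State → ℝ) (x : State) (c : ℝ) : Prop :=
  (∀ v ∈ tangent x, fderiv ℝ F x v = 0) ∧
    ∃ A : tangent x →ₗ[ℝ] tangent x,
      (∀ v : tangent x, (A v : State) = fderiv ℝ (sgrad lam F) x v) ∧
      A.charpoly = Polynomial.X ^ 4 * (Polynomial.X ^ 2 - Polynomial.C c)

/-- Critical point of rank 2 of type "center". -/
def IsCenter (a b lam : ℝ) (x : State) : Prop :=
  rank a b lam x = 2 ∧
    ∃ cH cK cG c : ℝ, c < 0 ∧ HasSquaredExponent lam (integral a b lam cH cK cG) x c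

/-- Critical point of rank 2 of type "saddle". -/
def IsSaddle (a b lam : ℝ) (x : State) : Prop :=
  rank a b lam x = 2 ∧
    ∃ cH cK cG c : ℝ, 0 < c ∧ HasSquaredExponent lam (integral a b lam cH cK cG) x c

/-- Degenerate critical point of rank 2: no linear combination of the integrals that is critical
at `x` has a nonzero characteristic exponent. -/
def IsDegenerate (a b lam : ℝ) (x : State) : Prop :=
  rank a b lam x = 2 ∧
    ¬ ∃ cH cK cG c : ℝ, c ≠ 0 ∧ HasSquaredExponent lam (integral a b lam cH cK cG) x c

/-! ### The critical subsystem `M₁` -/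

/-- `x₁ = (α₁ - β₂) + i (α₂ + β₁)`; `x₂` is its conjugate. -/
def x₁ (x : State) : ℂ := ⟨al x 0 - be x 1, al x 1 + be x 0⟩

def x₂ (x : State) : ℂ := ⟨al x 0 - be x 1, -(al x 1 + be x 0)⟩

/-- `y₁ = (α₁ + β₂) + i (α₂ - β₁)`; `y₂` is its conjugate. -/
def y₁ (x : State) : ℂ := ⟨al x 0 + be x 1, al x 1 - be x 0⟩

def y₂ (x : State) : ℂ := ⟨al x 0 + be x 1, -(al x 1 - be x 0)⟩

/-- `z₁ = α₃ + i β₃`; `z₂` is its conjugate. -/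
def z₁ (x : State) : ℂ := ⟨al x 2, be x 2⟩

def z₂ (x : State) : ℂ := ⟨al x 2, -be x 2⟩

/-- `w₁ = ω₁ + i ω₂`; `w₂` is its conjugate. -/
def w₁ (x : State) : ℂ := ⟨om x 0, om x 1⟩

def w₂ (x : State) : ℂ := ⟨om x 0, -om x 1⟩

def w₃ (x : State) : ℂ := (om x 2 : ℂ)

/-- `x₂ z₁ w₁ + x₁ z₂ w₂ + z₁ z₂ (w₃ + λ)`. -/
def num (lam : ℝ) (x : State) : ℂ :=
  x₂ x * z₁ x * w₁ x + x₁ x * z₂ x * w₂ x + z₁ x * z₂ x * (w₃ x + lam)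

/-- `w₁ w₂ (w₃ - λ)`. -/
def den (lam : ℝ) (x : State) : ℂ := w₁ x * w₂ x * (w₃ x - lam)

/-- The part of the phase space where the invariant relations of the first critical subsystem
are defined and hold. -/
def M1gen (a b lam : ℝ) : Set State :=
  {x | x ∈ phaseSpace a b ∧ den lam x ≠ 0 ∧
    y₁ x = -(1 / den lam x) *
      (w₁ x * (w₃ x - lam) * (x₂ x * w₁ x + z₂ x * (w₃ x + lam)) + num lam x) ∧
    y₂ x = -(1 / den lam x) *
      (w₂ x * (w₃ x - lam) * (x₁ x * w₂ x + z₁ x * (w₃ x + lam)) + num lam x)}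

/-- The critical subsystem `M₁`. -/
def M1 (a b lam : ℝ) : Set State := closure (M1gen a b lam)

/-- The partial integral `S₁` (its values are real). -/
def S1 (lam : ℝ) (x : State) : ℂ := num lam x / (2 * den lam x)

/-- `s` is the value of the partial integral `S₁` at `x ∈ M₁`, taken by continuity from the set
where the relations defining `M₁` make sense. -/
def IsS1Value (a b lam : ℝ) (x : State) (s : ℝ) : Prop :=
  Filter.Tendsto (S1 lam) (𝓝[M1gen a b lam] x) (𝓝 (s : ℂ))

/-! ### The surfaces `Π₁`, `Π₂`, in `ℝ³(h, k, g)`, with parameters `(s, h)`, `s ≠ 0` -/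

/-- `p² = a² + b²`. -/
def pSq (a b : ℝ) : ℝ := a ^ 2 + b ^ 2

/-- `r² = a² - b²`. -/
def rSq (a b : ℝ) : ℝ := a ^ 2 - b ^ 2

/-- Parametrization of `Π₁`. -/
def surf1 (a b lam : ℝ) (q : ℝ × ℝ) : ℝ × ℝ × ℝ :=
  (q.2,
    pSq a b + (q.2 - lam ^ 2 / 2) ^ 2 - 4 * (q.2 - lam ^ 2 / 2) * q.1 + 3 * q.1 ^ 2
      - (pSq a b ^ 2 - rSq a b ^ 2) / (4 * q.1 ^ 2),
    (q.2 - lam ^ 2 / 2 - q.1) * q.1 ^ 2 + (pSq a b ^ 2 - rSq a b ^ 2) / (4 * q.1))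

/-- Parametrization of `Π₂`. -/
def surf2 (a b lam : ℝ) (q : ℝ × ℝ) : ℝ × ℝ × ℝ :=
  (q.2,
    -2 * lam ^ 2 * (q.2 - lam ^ 2 / 2 - 2 * q.1) - lam ^ 4 + rSq a b ^ 2 / (4 * q.1 ^ 2),
    pSq a b * (q.2 + lam ^ 2 / 2) / 2 - lam ^ 2 * q.1 ^ 2 - rSq a b ^ 2 / (4 * q.1))

/-- A plane curve has an ordinary (semicubical) cusp at the parameter value `t`. -/
def HasCusp (γ : ℝ → ℝ × ℝ) (t : ℝ) : Prop :=
  deriv γ t = 0 ∧ LinearIndependent ℝ ![iteratedDeriv 2 γ t, iteratedDeriv 3 γ t]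

/-- The cuspidal edge (edge of regression) of `Π₁` in the parameter plane: the points at which the
section of `Π₁` by the plane `h = const` has an ordinary cusp, together with their limit points
(the points where the edge itself turns back). -/
def cuspidalEdge1 (a b lam : ℝ) : Set (ℝ × ℝ) :=
  closure {q | q.1 ≠ 0 ∧ HasCusp (fun t => (surf1 a b lam (t, q.2)).2) q.1}

/-- The curve of tangency of `Π₁` with `Π₂` in the parameter plane of `Π₁`: the points at which
both surfaces are regular and have the same tangent plane, together with their limit points. -/
def tangencyCurve (a b lam : ℝ) : Set (ℝ × ℝ) :=
  closure {q | q.1 ≠ 0 ∧ ∃ q' : ℝ × ℝ, q'.1 ≠ 0 ∧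
    surf2 a b lam q' = surf1 a b lam q ∧
    Function.Injective (fderiv ℝ (surf1 a b lam) q) ∧
    Function.Injective (fderiv ℝ (surf2 a b lam) q') ∧
    LinearMap.range (fderiv ℝ (surf1 a b lam) q : ℝ × ℝ →ₗ[ℝ] ℝ × ℝ × ℝ)
      = LinearMap.range (fderiv ℝ (surf2 a b lam) q' : ℝ × ℝ →ₗ[ℝ] ℝ × ℝ × ℝ)}

/-- The explicit squared characteristic exponent. -/
def muSq (a b lam s h : ℝ) : ℝ :=
  1 / (2 * s) * (12 * s ^ 4 - 8 * (h - lam ^ 2 / 2) * s ^ 3 + pSq a b ^ 2 - rSq a b ^ 2)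
    * (2 * s ^ 2 - 2 * (h + lam ^ 2 / 2) * s + pSq a b)

end KowalevskiGyrostat

end

/-!
Put `s = S₁`. The two equations defining `M₁` are equivalent, where `D ≠ 0`, to the vanishing of
polynomials in `(x, s)`, the components of `crossRel` and `dotRel`. These equations survive in the
closure: a component of `crossRel` is quadratic in `s`, so `S₁` stays bounded near a point of the
closure, and at a point of rank two the limit `s` is unique because it is the coefficient of `K` in
the critical combination of the integrals with coefficient `2` at `G`.

Up to a constant and to the geometric integrals, `s` times this combination is half a weighted sum
of squares of the relations. Its linearization at a common zero of the relations is therefore a sum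
of rank-one maps, and the squared exponent, which is half the trace of its square, becomes a
quadratic expression in the Poisson brackets of the relations. On the zero set that expression
factors into `cuspFactor` and `tangencyFactor`, which cut out the cuspidal edge of `Π₁` and the
curve of tangency with `Π₂`.
-/

noncomputable section

namespace KowalevskiGyrostat

theorem vec3_ext {R : Type*} {u v : Fin 3 → R} (h₀ : u 0 = v 0) (h₁ : u 1 = v 1) (h₂ : u 2 = v 2) :
    u = v :=
  funext <| Fin.forall_fin_succ.2 ⟨h₀, Fin.forall_fin_two.2 ⟨h₁, h₂⟩⟩

section Calculus

variable {E : Type*} [NormedAddCommGroup E] [NormedSpace ℝ E]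

theorem contDiff_dotProduct {ι : Type*} [Fintype ι] {n : WithTop ℕ∞} {f g : E → ι → ℝ}
    (hf : ContDiff ℝ n f) (hg : ContDiff ℝ n g) : ContDiff ℝ n fun y => f y ⬝ᵥ g y :=
  ContDiff.sum fun i _ => (contDiff_pi.1 hf i).mul (contDiff_pi.1 hg i)

theorem contDiff_crossProduct {n : WithTop ℕ∞} {f g : E → Fin 3 → ℝ}
    (hf : ContDiff ℝ n f) (hg : ContDiff ℝ n g) : ContDiff ℝ n fun y => f y ⨯₃ g y :=
  (crossProduct (R := ℝ)).toContinuousBilinearMap.isBoundedBilinearMap.contDiff.comp (hf.prodMk hg)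

theorem fderiv_dotProduct {ι : Type*} [Fintype ι] {f g : E → ι → ℝ} {x : E}
    (hf : DifferentiableAt ℝ f x) (hg : DifferentiableAt ℝ g x) (v : E) :
    fderiv ℝ (fun y => f y ⬝ᵥ g y) x v = fderiv ℝ f x v ⬝ᵥ g x + f x ⬝ᵥ fderiv ℝ g x v := by
  have h := (dotProductBilin ℝ ℝ (m := ι) (A := ℝ)).toContinuousBilinearMap.hasFDerivAt_of_bilinear
    hf.hasFDerivAt hg.hasFDerivAt
  rw [HasFDerivAt.fderiv (f := fun y => f y ⬝ᵥ g y) h]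
  simp [dotProductBilin, add_comm]

theorem fderiv_crossProduct {f g : E → Fin 3 → ℝ} {x : E}
    (hf : DifferentiableAt ℝ f x) (hg : DifferentiableAt ℝ g x) (v : E) :
    fderiv ℝ (fun y => f y ⨯₃ g y) x v = fderiv ℝ f x v ⨯₃ g x + f x ⨯₃ fderiv ℝ g x v := by
  have h := (crossProduct (R := ℝ)).toContinuousBilinearMap.hasFDerivAt_of_bilinear
    hf.hasFDerivAt hg.hasFDerivAt
  rw [HasFDerivAt.fderiv (f := fun y => f y ⨯₃ g y) h]
  simp [add_comm]

end Calculus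

section Coordinates

variable {n : WithTop ℕ∞} (x v : State)

theorem contDiff_om : ContDiff ℝ n om := contDiff_fst

theorem contDiff_al : ContDiff ℝ n al := contDiff_snd.fst

theorem contDiff_be : ContDiff ℝ n be := contDiff_snd.snd

theorem fderiv_om : fderiv ℝ om x v = om v := by
  change fderiv ℝ Prod.fst x v = _
  rw [fderiv_fst]; rfl

theorem fderiv_al : fderiv ℝ al x v = al v := by
  change fderiv ℝ (fun y : State => y.2.1) x v = _
  rw [fderiv.fst differentiableAt_snd, fderiv_snd]; rfl

theorem fderiv_be : fderiv ℝ be x v = be v := by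
  change fderiv ℝ (fun y : State => y.2.2) x v = _
  rw [fderiv.snd differentiableAt_snd, fderiv_snd]; rfl

theorem fderiv_om_apply (i : Fin 3) : fderiv ℝ (fun y => om y i) x v = om v i := by
  rw [fderiv_apply (contDiff_om.differentiable one_ne_zero x), ContinuousLinearMap.comp_apply,
    fderiv_om, ContinuousLinearMap.proj_apply]

theorem fderiv_al_apply (i : Fin 3) : fderiv ℝ (fun y => al y i) x v = al v i := by
  rw [fderiv_apply (contDiff_al.differentiable one_ne_zero x), ContinuousLinearMap.comp_apply,
    fderiv_al, ContinuousLinearMap.proj_apply]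

theorem fderiv_be_apply (i : Fin 3) : fderiv ℝ (fun y => be y i) x v = be v i := by
  rw [fderiv_apply (contDiff_be.differentiable one_ne_zero x), ContinuousLinearMap.comp_apply,
    fderiv_be, ContinuousLinearMap.proj_apply]

theorem contDiff_om_apply (i : Fin 3) : ContDiff ℝ n fun y => om y i := contDiff_pi.1 contDiff_om i

theorem contDiff_al_apply (i : Fin 3) : ContDiff ℝ n fun y => al y i := contDiff_pi.1 contDiff_al i

theorem contDiff_be_apply (i : Fin 3) : ContDiff ℝ n fun y => be y i := contDiff_pi.1 contDiff_be i

/-- The differential of the kinetic momentum, the linear change of the velocities `ω` into the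
momenta `M`. -/
def dmomentum (v : State) : Fin 3 → ℝ := ![2 * om v 0, 2 * om v 1, om v 2]

theorem contDiff_momentum (lam : ℝ) : ContDiff ℝ n (momentum lam) :=
  contDiff_pi.2 <| Fin.forall_fin_succ.2 ⟨contDiff_const.mul (contDiff_om_apply 0),
    Fin.forall_fin_two.2 ⟨contDiff_const.mul (contDiff_om_apply 1),
      (contDiff_om_apply 2).add contDiff_const⟩⟩

theorem fderiv_momentum (lam : ℝ) : fderiv ℝ (momentum lam) x v = dmomentum v := by
  have hcomp (i : Fin 3) : fderiv ℝ (momentum lam) x v i =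
      fderiv ℝ (fun y => momentum lam y i) x v := by
    rw [fderiv_apply ((contDiff_momentum lam).differentiable one_ne_zero x)]; rfl
  ext i
  rw [hcomp]
  fin_cases i
  · change fderiv ℝ (fun y => 2 * om y 0) x v = 2 * om v 0
    rw [fderiv_const_mul ((contDiff_om_apply 0).differentiable one_ne_zero x),
      smul_apply, fderiv_om_apply, smul_eq_mul]
  · change fderiv ℝ (fun y => 2 * om y 1) x v = 2 * om v 1
    rw [fderiv_const_mul ((contDiff_om_apply 1).differentiable one_ne_zero x),
      smul_apply, fderiv_om_apply, smul_eq_mul]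
  · change fderiv ℝ (fun y => om y 2 + lam) x v = om v 2
    rw [fderiv_add_const, fderiv_om_apply]

end Coordinates

section PoissonStructure

variable {lam : ℝ} {E F : State → ℝ} {x : State}

theorem fderiv_eq_grad (F : State → ℝ) (x v : State) :
    fderiv ℝ F x v = gradM F x ⬝ᵥ dmomentum v + gradAl F x ⬝ᵥ al v + gradBe F x ⬝ᵥ be v := by
  have hv : v = om v 0 • (Pi.single 0 1, 0, 0) + om v 1 • (Pi.single 1 1, 0, 0)
      + om v 2 • (Pi.single 2 1, 0, 0)
      + (al v 0 • (0, Pi.single 0 1, 0) + al v 1 • (0, Pi.single 1 1, 0)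
        + al v 2 • (0, Pi.single 2 1, 0))
      + (be v 0 • (0, 0, Pi.single 0 1) + be v 1 • (0, 0, Pi.single 1 1)
        + be v 2 • (0, 0, Pi.single 2 1)) := by
    refine Prod.ext (funext fun i => ?_) (Prod.ext (funext fun i => ?_) (funext fun i => ?_)) <;>
      fin_cases i <;> simp [om, al, be]
  conv_lhs => rw [hv]
  simp only [map_add, map_smul, smul_eq_mul, gradM, gradAl, gradBe, dmomentum,
    Matrix.vec3_dotProduct, Matrix.cons_val]
  ring

/-- The Hamiltonian operator of the Lie-Poisson bracket, applied to the covector with components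
`u`, `ξ`, `η` in the directions of `M`, `α`, `β`. -/
def hamiltonianOp (lam : ℝ) (x : State) (u ξ η : Fin 3 → ℝ) : State :=
  let m := momentum lam x ⨯₃ u + al x ⨯₃ ξ + be x ⨯₃ η
  (![m 0 / 2, m 1 / 2, m 2], al x ⨯₃ u, be x ⨯₃ u)

theorem sgrad_eq_hamiltonianOp {u ξ η : Fin 3 → ℝ}
    (h : ∀ v, fderiv ℝ F x v = u ⬝ᵥ dmomentum v + ξ ⬝ᵥ al v + η ⬝ᵥ be v) :
    sgrad lam F x = hamiltonianOp lam x u ξ η := by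
  have hu : gradM F x = u := by
    ext i; fin_cases i <;>
      simp [gradM, h, dmomentum, om, al, be, Matrix.vecHead, Matrix.vecTail]
  have hξ : gradAl F x = ξ := by
    ext i; simp [gradAl, h, dmomentum, om, al, be]
  have hη : gradBe F x = η := by
    ext i; simp [gradBe, h, dmomentum, om, al, be]
  rw [← hu, ← hξ, ← hη]; rfl

theorem dmomentum_hamiltonianOp (u ξ η : Fin 3 → ℝ) :
    dmomentum (hamiltonianOp lam x u ξ η) = momentum lam x ⨯₃ u + al x ⨯₃ ξ + be x ⨯₃ η := by
  ext i; fin_cases i <;> simp [dmomentum, hamiltonianOp, om] <;> ring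

theorem al_hamiltonianOp (u ξ η : Fin 3 → ℝ) : al (hamiltonianOp lam x u ξ η) = al x ⨯₃ u := rfl

theorem be_hamiltonianOp (u ξ η : Fin 3 → ℝ) : be (hamiltonianOp lam x u ξ η) = be x ⨯₃ u := rfl

theorem om_hamiltonianOp_two (u ξ η : Fin 3 → ℝ) :
    om (hamiltonianOp lam x u ξ η) 2 = (momentum lam x ⨯₃ u + al x ⨯₃ ξ + be x ⨯₃ η) 2 := rfl

theorem dmomentum_sgrad (F : State → ℝ) : dmomentum (sgrad lam F x) = momentumRate lam F x :=
  dmomentum_hamiltonianOp _ _ _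

/-- The Poisson bracket `{E, F}`: the derivative of `E` along the Hamiltonian field of `F`. -/
def poissonBracket (lam : ℝ) (E F : State → ℝ) (x : State) : ℝ := fderiv ℝ E x (sgrad lam F x)

theorem poissonBracket_comm (lam : ℝ) (E F : State → ℝ) (x : State) :
    poissonBracket lam E F x = -poissonBracket lam F E x := by
  rw [poissonBracket, poissonBracket, fderiv_eq_grad, fderiv_eq_grad F, dmomentum_sgrad,
    dmomentum_sgrad]
  simp only [momentumRate, sgrad, al, be, Matrix.vec3_dotProduct, cross_apply,
    Pi.add_apply, Matrix.cons_val]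
  ring

theorem poissonBracket_self (lam : ℝ) (F : State → ℝ) (x : State) :
    poissonBracket lam F F x = 0 :=
  self_eq_neg.1 (poissonBracket_comm lam F F x)

theorem hamiltonianOp_add (u ξ η u' ξ' η' : Fin 3 → ℝ) :
    hamiltonianOp lam x (u + u') (ξ + ξ') (η + η') =
      hamiltonianOp lam x u ξ η + hamiltonianOp lam x u' ξ' η' := by
  refine Prod.ext (funext fun i => ?_) (Prod.ext (map_add _ _ _) (map_add _ _ _))
  fin_cases i <;> simp [hamiltonianOp] <;> ring

theorem hamiltonianOp_smul (c : ℝ) (u ξ η : Fin 3 → ℝ) :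
    hamiltonianOp lam x (c • u) (c • ξ) (c • η) = c • hamiltonianOp lam x u ξ η := by
  refine Prod.ext (funext fun i => ?_) (Prod.ext (map_smul _ _ _) (map_smul _ _ _))
  fin_cases i <;> simp [hamiltonianOp] <;> ring

theorem sgrad_const (c : ℝ) : sgrad lam (fun _ => c) x = 0 := by
  rw [sgrad_eq_hamiltonianOp (u := 0) (ξ := 0) (η := 0) (by simp)]
  simpa using hamiltonianOp_smul (lam := lam) (x := x) 0 0 0 0

theorem sgrad_add (hE : DifferentiableAt ℝ E x) (hF : DifferentiableAt ℝ F x) :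
    sgrad lam (fun y => E y + F y) x = sgrad lam E x + sgrad lam F x := by
  refine (sgrad_eq_hamiltonianOp fun v => ?_).trans (hamiltonianOp_add ..)
  rw [fderiv_fun_add hE hF, add_apply, fderiv_eq_grad E, fderiv_eq_grad F]
  simp only [add_dotProduct]
  ring

theorem sgrad_const_mul (c : ℝ) (hF : DifferentiableAt ℝ F x) :
    sgrad lam (fun y => c * F y) x = c • sgrad lam F x := by
  refine (sgrad_eq_hamiltonianOp fun v => ?_).trans (hamiltonianOp_smul ..)
  rw [fderiv_const_mul hF, smul_apply, fderiv_eq_grad F]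
  simp only [smul_dotProduct, smul_add]

theorem sgrad_sum {ι : Type*} (t : Finset ι) {F : ι → State → ℝ}
    (hF : ∀ i ∈ t, DifferentiableAt ℝ (F i) x) :
    sgrad lam (fun y => ∑ i ∈ t, F i y) x = ∑ i ∈ t, sgrad lam (F i) x := by
  classical
  induction t using Finset.induction_on with
  | empty => simp only [Finset.sum_empty, sgrad_const]
  | insert i t hi ih =>
    simp only [Finset.forall_mem_insert] at hF
    simp only [Finset.sum_insert hi]
    rw [sgrad_add hF.1 (DifferentiableAt.fun_sum hF.2), ih hF.2]

theorem sgrad_mul (hE : DifferentiableAt ℝ E x) (hF : DifferentiableAt ℝ F x) :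
    sgrad lam (fun y => E y * F y) x = E x • sgrad lam F x + F x • sgrad lam E x := by
  change _ = E x • hamiltonianOp lam x _ _ _ + F x • hamiltonianOp lam x _ _ _
  rw [← hamiltonianOp_smul, ← hamiltonianOp_smul, ← hamiltonianOp_add]
  refine sgrad_eq_hamiltonianOp fun v => ?_
  rw [fderiv_fun_mul hE hF, add_apply, smul_apply, smul_apply, fderiv_eq_grad E, fderiv_eq_grad F]
  simp only [add_dotProduct, smul_dotProduct, smul_eq_mul]
  ring

theorem differentiable_sgrad (hF : ContDiff ℝ 2 F) : Differentiable ℝ (sgrad lam F) := by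
  have hd (v : State) : ContDiff ℝ 1 fun y => fderiv ℝ F y v :=
    (hF.fderiv_right (m := 1) le_rfl).clm_apply contDiff_const
  have hu : ContDiff ℝ 1 (gradM F) := contDiff_pi.2 <| Fin.forall_fin_succ.2
    ⟨(hd _).div_const 2, Fin.forall_fin_two.2 ⟨(hd _).div_const 2, hd _⟩⟩
  have hm : ContDiff ℝ 1 (momentumRate lam F) :=
    ((contDiff_crossProduct (contDiff_momentum lam) hu).add
      (contDiff_crossProduct contDiff_al (contDiff_pi.2 fun _ => hd _))).add
      (contDiff_crossProduct contDiff_be (contDiff_pi.2 fun _ => hd _))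
  have hm' (i : Fin 3) : ContDiff ℝ 1 fun y => momentumRate lam F y i := contDiff_pi.1 hm i
  have hω : ContDiff ℝ 1 fun y => om (sgrad lam F y) := contDiff_pi.2 <| Fin.forall_fin_succ.2
    ⟨(hm' 0).div_const 2, Fin.forall_fin_two.2 ⟨(hm' 1).div_const 2, hm' 2⟩⟩
  exact (hω.prodMk ((contDiff_crossProduct contDiff_al hu).prodMk
    (contDiff_crossProduct contDiff_be hu))).differentiable one_ne_zero

theorem fderiv_sgrad_mul (hE : ContDiff ℝ 2 E) (hF : ContDiff ℝ 2 F) (v : State) :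
    fderiv ℝ (sgrad lam fun y => E y * F y) x v =
      fderiv ℝ E x v • sgrad lam F x + E x • fderiv ℝ (sgrad lam F) x v
        + (fderiv ℝ F x v • sgrad lam E x + F x • fderiv ℝ (sgrad lam E) x v) := by
  have hEd := hE.differentiable two_ne_zero
  have hFd := hF.differentiable two_ne_zero
  have hsE := differentiable_sgrad (lam := lam) hE
  have hsF := differentiable_sgrad (lam := lam) hF
  have hmul : (sgrad lam fun y => E y * F y) =
      fun y => E y • sgrad lam F y + F y • sgrad lam E y :=
    funext fun y => sgrad_mul (hEd y) (hFd y)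
  rw [hmul, fderiv_fun_add ((hEd x).fun_smul (hsF x)) ((hFd x).fun_smul (hsE x)),
    fderiv_fun_smul (hEd x) (hsF x), fderiv_fun_smul (hFd x) (hsE x)]
  simp only [add_apply, smul_apply, ContinuousLinearMap.smulRight_apply]
  abel

theorem fderiv_sgrad_of_const_mul_eq_add_sum_mul {ι : Type*} [Fintype ι] {s k : ℝ}
    {P Q : ι → State → ℝ} (hF : ContDiff ℝ 2 F) (hP : ∀ i, ContDiff ℝ 2 (P i))
    (hQ : ∀ i, ContDiff ℝ 2 (Q i)) (h : ∀ y, s * F y = k + ∑ i, P i y * Q i y) (v : State) :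
    s • fderiv ℝ (sgrad lam F) x v =
      ∑ i, fderiv ℝ (sgrad lam fun y => P i y * Q i y) x v := by
  have hPQ (i : ι) := (hP i).mul (hQ i)
  have hsgrad : (fun y => s • sgrad lam F y) = fun y => ∑ i, sgrad lam (fun y => P i y * Q i y) y :=
    funext fun y => by
      rw [← sgrad_const_mul s (hF.differentiable two_ne_zero y), funext h,
        sgrad_add (differentiableAt_const k) (.fun_sum fun i _ =>
          (hPQ i).differentiable two_ne_zero y), sgrad_const, zero_add,
        sgrad_sum _ fun i _ => (hPQ i).differentiable two_ne_zero y]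
  have hderiv := congrArg (fun f => fderiv ℝ f x v) hsgrad
  simpa only [fderiv_fun_const_smul (differentiable_sgrad hF x), smul_apply,
    fderiv_fun_sum fun i _ => differentiable_sgrad (hPQ i) x, sum_apply]
    using hderiv

end PoissonStructure

section Relations

variable {a b lam s : ℝ} {x : State}

/-- The vector `α + s e₁`. -/
def shiftAl (s : ℝ) (x : State) : Fin 3 → ℝ := ![al x 0 + s, al x 1, al x 2]

/-- The vector `β + s e₂`. -/
def shiftBe (s : ℝ) (x : State) : Fin 3 → ℝ := ![be x 0, be x 1 + s, be x 2]

/-- The vector-valued function whose vanishing says that the cross product of the shifted force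
vectors is `s (ω₃ - λ) / 2` times the kinetic momentum. -/
def crossRel (lam s : ℝ) (x : State) : Fin 3 → ℝ :=
  shiftAl s x ⨯₃ shiftBe s x - (s * (om x 2 - lam) / 2) • momentum lam x

/-- The pair of functions whose vanishing says that the kinetic momentum is orthogonal to the
shifted force vectors. -/
def dotRel (lam s : ℝ) (x : State) : Fin 2 → ℝ :=
  ![momentum lam x ⬝ᵥ shiftAl s x, momentum lam x ⬝ᵥ shiftBe s x]

/-- The vector `τ` with `s τ = α × β - s² e₃` wherever `crossRel` vanishes, written without division
by `s`. -/
def tau (lam s : ℝ) (x : State) : Fin 3 → ℝ :=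
  ![(om x 2 - lam) * om x 0 + al x 2, (om x 2 - lam) * om x 1 + be x 2,
    (om x 2 ^ 2 - lam ^ 2) / 2 - al x 0 - be x 1 - 2 * s]

/-- The polynomial form of the relations defining the first critical subsystem; `s` is the value of
the partial integral `S₁`. -/
structure IsCriticalPair (a b lam s : ℝ) (x : State) : Prop where
  mem_phaseSpace : x ∈ phaseSpace a b
  crossRel_eq_zero : crossRel lam s x = 0
  dotRel_eq_zero : dotRel lam s x = 0

theorem mem_phaseSpace_iff :
    x ∈ phaseSpace a b ↔
      al x ⬝ᵥ al x = a ^ 2 ∧ be x ⬝ᵥ be x = b ^ 2 ∧ al x ⬝ᵥ be x = 0 := by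
  simp only [phaseSpace, geom, Set.mem_ofPred_eq, Prod.mk.injEq]

theorem smul_tau (lam s : ℝ) (x : State) :
    s • tau lam s x = al x ⨯₃ be x - ![0, 0, s ^ 2] - crossRel lam s x := by
  ext i; fin_cases i <;>
    simp [tau, crossRel, shiftAl, shiftBe, momentum, cross_apply] <;> ring

theorem sq_mul_K (a b lam s : ℝ) (x : State) :
    s ^ 2 * K lam x =
      s ^ 2 * (pSq a b + (H x - lam ^ 2 / 2) ^ 2 - 4 * (H x - lam ^ 2 / 2) * s + 3 * s ^ 2)
        - a ^ 2 * b ^ 2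
        + (2 * s * (tau lam s x ⬝ᵥ crossRel lam s x) + crossRel lam s x ⬝ᵥ crossRel lam s x)
        + 2 * s ^ 2 * (om x 0 * dotRel lam s x 0 + om x 1 * dotRel lam s x 1)
        + (s ^ 2 - be x ⬝ᵥ be x) * (al x ⬝ᵥ al x - a ^ 2) + (s ^ 2 - a ^ 2) * (be x ⬝ᵥ be x - b ^ 2)
        + (al x ⬝ᵥ be x) * (al x ⬝ᵥ be x) := by
  simp only [K, pSq, H, tau, crossRel, dotRel, shiftAl, shiftBe, momentum, cross_apply,
    Matrix.vec3_dotProduct, Matrix.cons_val, Pi.sub_apply, Pi.smul_apply, smul_eq_mul]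
  ring

theorem mul_G (a b lam s : ℝ) (x : State) :
    s * G a b lam x =
      s * ((H x - lam ^ 2 / 2 - s) * s ^ 2) + a ^ 2 * b ^ 2
        - (s * (tau lam s x ⬝ᵥ crossRel lam s x) + crossRel lam s x ⬝ᵥ crossRel lam s x)
        - s ^ 2 * (om x 0 * dotRel lam s x 0 + om x 1 * dotRel lam s x 1)
        + s / 4 * (dotRel lam s x 0 ^ 2 + dotRel lam s x 1 ^ 2)
        + (s * be x 1 + be x ⬝ᵥ be x) * (al x ⬝ᵥ al x - a ^ 2)
        + (s * al x 0 + a ^ 2) * (be x ⬝ᵥ be x - b ^ 2)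
        - (s * (al x 1 + be x 0) + al x ⬝ᵥ be x) * (al x ⬝ᵥ be x) := by
  simp only [G, H, tau, crossRel, dotRel, shiftAl, shiftBe, momentum, cross_apply,
    Matrix.vec3_dotProduct, Matrix.cons_val, Pi.sub_apply, Pi.smul_apply, smul_eq_mul]
  ring

theorem crossRel_two (lam s : ℝ) (x : State) :
    crossRel lam s x 2 = s ^ 2 - s * ((om x 2 ^ 2 - lam ^ 2) / 2 - al x 0 - be x 1)
      + (al x ⨯₃ be x) 2 := by
  simp only [crossRel, shiftAl, shiftBe, momentum, cross_apply, Pi.sub_apply, Pi.smul_apply,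
    smul_eq_mul, Matrix.cons_val]
  ring

theorem momentum_cross_crossRel (lam s : ℝ) (x : State) :
    momentum lam x ⨯₃ crossRel lam s x =
      dotRel lam s x 1 • shiftAl s x - dotRel lam s x 0 • shiftBe s x := by
  simp only [crossRel, dotRel, map_sub, map_smul, cross_self, smul_zero, sub_zero,
    cross_cross_eq_smul_sub_smul', Matrix.cons_val,
    dotProduct_comm (shiftAl s x)]

namespace IsCriticalPair

variable (hx : IsCriticalPair a b lam s x)

include hx

theorem dotRel_zero : momentum lam x ⬝ᵥ shiftAl s x = 0 := congrFun hx.dotRel_eq_zero 0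

theorem dotRel_one : momentum lam x ⬝ᵥ shiftBe s x = 0 := congrFun hx.dotRel_eq_zero 1

theorem smul_tau_eq : s • tau lam s x = al x ⨯₃ be x - ![0, 0, s ^ 2] := by
  rw [smul_tau, hx.crossRel_eq_zero, sub_zero]

theorem momentum_cross_tau :
    momentum lam x ⨯₃ tau lam s x = (2 : ℝ) • (om x 0 • shiftBe s x - om x 1 • shiftAl s x) := by
  have h0 := hx.dotRel_zero
  have h1 := hx.dotRel_one
  ext i
  fin_cases i <;>
    simp only [momentum, shiftAl, shiftBe, tau, cross_apply, Matrix.vec3_dotProduct,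
      Matrix.cons_val, Pi.sub_apply, Pi.smul_apply, smul_eq_mul, Fin.zero_eta, Fin.mk_one,
      Fin.reduceFinMk] at h0 h1 ⊢
  · linear_combination -h1
  · linear_combination h0
  · ring

theorem ne_zero (ha : a ≠ 0) (hb : b ≠ 0) : s ≠ 0 := by
  rintro rfl
  obtain ⟨hα, hβ, hαβ⟩ := mem_phaseSpace_iff.1 hx.mem_phaseSpace
  have hγ : al x ⨯₃ be x = 0 := by
    have h0 : ![0, 0, (0 : ℝ) ^ 2] = 0 := by ext i; fin_cases i <;> simp
    have hτ := hx.smul_tau_eq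
    rwa [zero_smul, h0, sub_zero, eq_comm] at hτ
  have hnorm := cross_dot_cross (al x) (be x) (al x) (be x)
  rw [hγ, hα, hβ, hαβ] at hnorm
  simp [ha, hb] at hnorm

theorem shiftAl_dot_tau : shiftAl s x ⬝ᵥ tau lam s x = s * (om x 2 - lam) * om x 0 := by
  have hV := hx.dotRel_zero
  have hU := congrFun hx.crossRel_eq_zero 0
  simp only [crossRel, momentum, shiftAl, shiftBe, tau, cross_apply, Matrix.vec3_dotProduct,
    Matrix.cons_val, Pi.sub_apply, Pi.smul_apply, Pi.zero_apply, smul_eq_mul] at hV hU ⊢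
  linear_combination (om x 2 - lam) / 2 * hV + hU

theorem shiftBe_dot_tau : shiftBe s x ⬝ᵥ tau lam s x = s * (om x 2 - lam) * om x 1 := by
  have hV := hx.dotRel_one
  have hU := congrFun hx.crossRel_eq_zero 1
  simp only [crossRel, momentum, shiftAl, shiftBe, tau, cross_apply, Matrix.vec3_dotProduct,
    Matrix.cons_val, Pi.sub_apply, Pi.smul_apply, Pi.zero_apply, smul_eq_mul] at hV hU ⊢
  linear_combination (om x 2 - lam) / 2 * hV + hU

theorem J_eq_surf1 (hs : s ≠ 0) : J a b lam x = surf1 a b lam (s, H x) := by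
  obtain ⟨hα, hβ, hαβ⟩ := mem_phaseSpace_iff.1 hx.mem_phaseSpace
  have hK := sq_mul_K a b lam s x
  have hG := mul_G a b lam s x
  simp only [hx.crossRel_eq_zero, hx.dotRel_eq_zero, hα, hβ, hαβ, dotProduct_zero, Pi.zero_apply]
    at hK hG
  simp only [J, surf1, Prod.mk.injEq, true_and, pSq, rSq] at hK ⊢
  constructor
  · field_simp
    linear_combination 16 * hK
  · field_simp
    linear_combination 8 * hG

end IsCriticalPair

/-- The factor of the squared exponent which vanishes on the cuspidal edge. -/
def cuspFactor (a b lam s h : ℝ) : ℝ :=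
  12 * s ^ 4 - 8 * (h - lam ^ 2 / 2) * s ^ 3 + pSq a b ^ 2 - rSq a b ^ 2

/-- The factor of the squared exponent which vanishes on the tangency curve. -/
def tangencyFactor (a b lam s h : ℝ) : ℝ :=
  2 * s ^ 2 - 2 * (h + lam ^ 2 / 2) * s + pSq a b

theorem IsCriticalPair.cuspFactor_eq (hx : IsCriticalPair a b lam s x) :
    cuspFactor a b lam s (H x) =
      4 * s ^ 2 * (tau lam s x ⬝ᵥ tau lam s x - 2 * s * (om x 0 ^ 2 + om x 1 ^ 2)) := by
  obtain ⟨hα, hβ, hαβ⟩ := mem_phaseSpace_iff.1 hx.mem_phaseSpace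
  have hU := congrFun hx.crossRel_eq_zero 2
  rw [crossRel_two, Pi.zero_apply] at hU
  have hγ := cross_dot_cross (al x) (be x) (al x) (be x)
  rw [hα, hβ, hαβ, Matrix.vec3_dotProduct] at hγ
  have hτ : s ^ 2 * (tau lam s x ⬝ᵥ tau lam s x) =
      (al x ⨯₃ be x) 0 ^ 2 + (al x ⨯₃ be x) 1 ^ 2 + ((al x ⨯₃ be x) 2 - s ^ 2) ^ 2 := by
    have h : s ^ 2 * (tau lam s x ⬝ᵥ tau lam s x) = (s • tau lam s x) ⬝ᵥ (s • tau lam s x) := by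
      simp only [smul_dotProduct, dotProduct_smul, smul_eq_mul]
      ring
    rw [h, hx.smul_tau_eq, Matrix.vec3_dotProduct]
    simp only [Pi.sub_apply, Matrix.cons_val]
    ring
  rw [cuspFactor, pSq, rSq, H]
  linear_combination -4 * hτ + 8 * s ^ 2 * hU - 4 * hγ

theorem tangencyFactor_eq (hx : x ∈ phaseSpace a b) :
    tangencyFactor a b lam s (H x) =
      shiftAl s x ⬝ᵥ shiftAl s x + shiftBe s x ⬝ᵥ shiftBe s x
        - s / 2 * (momentum lam x ⬝ᵥ momentum lam x + (om x 2 - lam) ^ 2) := by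
  obtain ⟨hα, hβ, -⟩ := mem_phaseSpace_iff.1 hx
  simp only [tangencyFactor, pSq, H, shiftAl, shiftBe, momentum, Matrix.vec3_dotProduct,
    Matrix.cons_val] at hα hβ ⊢
  linear_combination -hα - hβ

theorem muSq_eq (a b lam s h : ℝ) :
    muSq a b lam s h = cuspFactor a b lam s h * tangencyFactor a b lam s h / (2 * s) := by
  rw [muSq, cuspFactor, tangencyFactor]
  ring

end Relations

section Differentials

variable {lam s : ℝ} {n : WithTop ℕ∞} {x : State}

theorem shiftAl_eq (s : ℝ) : shiftAl s = fun y => al y + ![s, 0, 0] := by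
  ext y i; fin_cases i <;> simp [shiftAl]

theorem shiftBe_eq (s : ℝ) : shiftBe s = fun y => be y + ![0, s, 0] := by
  ext y i; fin_cases i <;> simp [shiftBe]

theorem contDiff_shiftAl (s : ℝ) : ContDiff ℝ n (shiftAl s) :=
  shiftAl_eq s ▸ contDiff_al.add contDiff_const

theorem contDiff_shiftBe (s : ℝ) : ContDiff ℝ n (shiftBe s) :=
  shiftBe_eq s ▸ contDiff_be.add contDiff_const

theorem fderiv_shiftAl (s : ℝ) (x v : State) : fderiv ℝ (shiftAl s) x v = al v := by
  rw [shiftAl_eq, fderiv_add_const]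
  exact fderiv_al x v

theorem fderiv_shiftBe (s : ℝ) (x v : State) : fderiv ℝ (shiftBe s) x v = be v := by
  rw [shiftBe_eq, fderiv_add_const]
  exact fderiv_be x v

theorem contDiff_crossRel (lam s : ℝ) : ContDiff ℝ n (crossRel lam s) :=
  (contDiff_crossProduct (contDiff_shiftAl s) (contDiff_shiftBe s)).sub
    (((contDiff_const.mul ((contDiff_om_apply 2).sub contDiff_const)).div_const 2).smul
      (contDiff_momentum lam))

theorem contDiff_dotRel (lam s : ℝ) : ContDiff ℝ n (dotRel lam s) :=
  contDiff_pi.2 <| Fin.forall_fin_two.2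
    ⟨contDiff_dotProduct (contDiff_momentum lam) (contDiff_shiftAl s),
      contDiff_dotProduct (contDiff_momentum lam) (contDiff_shiftBe s)⟩

theorem contDiff_H : ContDiff ℝ n H :=
  (((((contDiff_om_apply 0).pow 2).add ((contDiff_om_apply 1).pow 2)).add
    (((contDiff_om_apply 2).pow 2).div_const 2)).sub (contDiff_al_apply 0)).sub
    (contDiff_be_apply 1)

theorem fderiv_H (x v : State) :
    fderiv ℝ H x v = om x ⬝ᵥ dmomentum v - al v 0 - be v 1 := by
  have hω := (contDiff_om (n := 1)).differentiable one_ne_zero x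
  have hM := (contDiff_momentum (n := 1) 0).differentiable one_ne_zero x
  have hωM := (contDiff_dotProduct (contDiff_om (n := 1))
    (contDiff_momentum 0)).differentiable one_ne_zero x
  have hα := (contDiff_al_apply (n := 1) 0).differentiable one_ne_zero x
  have hβ := (contDiff_be_apply (n := 1) 1).differentiable one_ne_zero x
  have hH : H = fun y => 1 / 2 * (om y ⬝ᵥ momentum 0 y) - al y 0 - be y 1 := by
    funext y
    simp only [H, momentum, Matrix.vec3_dotProduct, Matrix.cons_val]
    ring
  rw [hH, fderiv_fun_sub ((hωM.const_mul _).fun_sub hα) hβ, fderiv_fun_sub (hωM.const_mul _) hα,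
    sub_apply, sub_apply, fderiv_al_apply, fderiv_be_apply, fderiv_const_mul hωM, smul_apply,
    fderiv_dotProduct hω hM, fderiv_om, fderiv_momentum, smul_eq_mul]
  simp only [momentum, dmomentum, Matrix.vec3_dotProduct, Matrix.cons_val]
  ring

theorem fderiv_crossRel (x v : State) :
    fderiv ℝ (crossRel lam s) x v =
      al v ⨯₃ shiftBe s x + shiftAl s x ⨯₃ be v - (s / 2 * om v 2) • momentum lam x
        - (s * (om x 2 - lam) / 2) • dmomentum v := by
  have hA := (contDiff_shiftAl s).differentiable one_ne_zero x
  have hB := (contDiff_shiftBe s).differentiable one_ne_zero x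
  have hM := (contDiff_momentum lam).differentiable one_ne_zero x
  have hδ : HasFDerivAt (fun y => s * (om y 2 - lam) / 2) ((s / 2) • fderiv ℝ (fun y => om y 2) x)
      x := by
    have h := (((contDiff_om_apply (n := 1) 2).differentiable one_ne_zero x).hasFDerivAt.sub_const
      lam).const_mul (s / 2)
    simpa only [div_mul_eq_mul_div] using h
  change fderiv ℝ (fun y => shiftAl s y ⨯₃ shiftBe s y - _) x v = _
  rw [fderiv_fun_sub ((contDiff_crossProduct (contDiff_shiftAl s)
    (contDiff_shiftBe s)).differentiable one_ne_zero x) (hδ.differentiableAt.fun_smul hM),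
    sub_apply, fderiv_crossProduct hA hB, fderiv_shiftAl, fderiv_shiftBe,
    fderiv_fun_smul hδ.differentiableAt hM, hδ.fderiv]
  simp only [add_apply, smul_apply, ContinuousLinearMap.smulRight_apply, fderiv_momentum,
    fderiv_om_apply, smul_eq_mul]
  abel

theorem fderiv_dotRel_zero (x v : State) :
    fderiv ℝ (fun y => dotRel lam s y 0) x v =
      dmomentum v ⬝ᵥ shiftAl s x + momentum lam x ⬝ᵥ al v := by
  change fderiv ℝ (fun y => momentum lam y ⬝ᵥ shiftAl s y) x v = _
  rw [fderiv_dotProduct ((contDiff_momentum lam).differentiable one_ne_zero x)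
    ((contDiff_shiftAl s).differentiable one_ne_zero x), fderiv_momentum, fderiv_shiftAl]

theorem fderiv_dotRel_one (x v : State) :
    fderiv ℝ (fun y => dotRel lam s y 1) x v =
      dmomentum v ⬝ᵥ shiftBe s x + momentum lam x ⬝ᵥ be v := by
  change fderiv ℝ (fun y => momentum lam y ⬝ᵥ shiftBe s y) x v = _
  rw [fderiv_dotProduct ((contDiff_momentum lam).differentiable one_ne_zero x)
    ((contDiff_shiftBe s).differentiable one_ne_zero x), fderiv_momentum, fderiv_shiftBe]

theorem fderiv_dotProduct_crossRel (c : Fin 3 → ℝ) (x v : State) :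
    fderiv ℝ (fun y => c ⬝ᵥ crossRel lam s y) x v = c ⬝ᵥ fderiv ℝ (crossRel lam s) x v := by
  rw [fderiv_dotProduct (differentiableAt_const c)
    ((contDiff_crossRel lam s).differentiable one_ne_zero x)]
  simp

theorem sgrad_H : sgrad lam H x = hamiltonianOp lam x (om x) ![-1, 0, 0] ![0, -1, 0] :=
  sgrad_eq_hamiltonianOp fun v => by
    simp only [fderiv_H, Matrix.vec3_dotProduct, Matrix.cons_val]
    ring

theorem sgrad_dotRel_zero :
    sgrad lam (fun y => dotRel lam s y 0) x =
      hamiltonianOp lam x (shiftAl s x) (momentum lam x) 0 :=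
  sgrad_eq_hamiltonianOp fun v => by
    rw [fderiv_dotRel_zero, zero_dotProduct, add_zero, dotProduct_comm (dmomentum v)]

theorem sgrad_dotRel_one :
    sgrad lam (fun y => dotRel lam s y 1) x =
      hamiltonianOp lam x (shiftBe s x) 0 (momentum lam x) :=
  sgrad_eq_hamiltonianOp fun v => by
    rw [fderiv_dotRel_one, zero_dotProduct, add_zero, dotProduct_comm (dmomentum v)]

theorem sgrad_dotProduct_crossRel (c : Fin 3 → ℝ) :
    sgrad lam (fun y => c ⬝ᵥ crossRel lam s y) x =
      hamiltonianOp lam x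
        (-(s * (om x 2 - lam) / 2) • c - (s / 2 * (c ⬝ᵥ momentum lam x)) • ![0, 0, 1])
        (shiftBe s x ⨯₃ c) (c ⨯₃ shiftAl s x) :=
  sgrad_eq_hamiltonianOp fun v => by
    rw [fderiv_dotProduct_crossRel, fderiv_crossRel]
    simp only [Matrix.vec3_dotProduct, cross_apply, Matrix.cons_val, Pi.add_apply, Pi.sub_apply,
      Pi.smul_apply, smul_eq_mul, dmomentum]
    ring

end Differentials

section Brackets

variable {a b lam s : ℝ} {x : State}

/-- The vector `p` with `{U, c · U} = c × p` on the first critical subsystem, where `U` is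
`crossRel`. -/
def crossBracket (lam s : ℝ) (x : State) : Fin 3 → ℝ :=
  (s ^ 2 * (om x 2 - lam) / 2) • tau lam s x
    - s ^ 2 • (om x 0 • shiftAl s x + om x 1 • shiftBe s x)

/-- The vectors `{U, Vⱼ}` on the first critical subsystem, where `U` is `crossRel` and `Vⱼ` are the
components of `dotRel`. -/
def mixedBracket (lam s : ℝ) (x : State) : Fin 2 → Fin 3 → ℝ :=
  ![(s ^ 2 * om x 1) • momentum lam x - s • (shiftAl s x ⨯₃ tau lam s x),
    -(s ^ 2 * om x 0) • momentum lam x - s • (shiftBe s x ⨯₃ tau lam s x)]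

namespace IsCriticalPair

variable (hx : IsCriticalPair a b lam s x)

include hx

theorem coordinate_relations :
    2 * om x 0 * (al x 0 + s) + 2 * om x 1 * al x 1 + (om x 2 + lam) * al x 2 = 0 ∧
      2 * om x 0 * be x 0 + 2 * om x 1 * (be x 1 + s) + (om x 2 + lam) * be x 2 = 0 ∧
      al x 1 * be x 2 - al x 2 * (be x 1 + s) - s * (om x 2 - lam) / 2 * (2 * om x 0) = 0 ∧
      al x 2 * be x 0 - (al x 0 + s) * be x 2 - s * (om x 2 - lam) / 2 * (2 * om x 1) = 0 ∧
      (al x 0 + s) * (be x 1 + s) - al x 1 * be x 0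
        - s * (om x 2 - lam) / 2 * (om x 2 + lam) = 0 := by
  have hV₀ := hx.dotRel_zero
  have hV₁ := hx.dotRel_one
  simp only [Matrix.vec3_dotProduct, momentum, shiftAl, shiftBe, Matrix.cons_val] at hV₀ hV₁
  exact ⟨hV₀, hV₁, congrFun hx.crossRel_eq_zero 0, congrFun hx.crossRel_eq_zero 1,
    congrFun hx.crossRel_eq_zero 2⟩

theorem fderiv_crossRel_sgrad_dotRel (j : Fin 2) :
    fderiv ℝ (crossRel lam s) x (sgrad lam (fun y => dotRel lam s y j) x) =
      mixedBracket lam s x j := by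
  obtain ⟨-, hV₁, hU₀, hU₁, hU₂⟩ := hx.coordinate_relations
  revert j
  refine Fin.forall_fin_two.2 ⟨?_, ?_⟩
  · rw [sgrad_dotRel_zero, fderiv_crossRel, dmomentum_hamiltonianOp, om_hamiltonianOp_two,
      al_hamiltonianOp, be_hamiltonianOp]
    refine vec3_ext ?_ ?_ ?_ <;>
      simp only [mixedBracket, momentum, shiftAl, shiftBe, tau, cross_apply, Pi.add_apply,
        Pi.sub_apply, Pi.smul_apply, Pi.zero_apply, smul_eq_mul, Matrix.cons_val] <;> grind
  · rw [sgrad_dotRel_one, fderiv_crossRel, dmomentum_hamiltonianOp, om_hamiltonianOp_two,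
      al_hamiltonianOp, be_hamiltonianOp]
    refine vec3_ext ?_ ?_ ?_ <;>
      simp only [mixedBracket, momentum, shiftAl, shiftBe, tau, cross_apply, Pi.add_apply,
        Pi.sub_apply, Pi.smul_apply, Pi.zero_apply, smul_eq_mul, Matrix.cons_val] <;> grind

theorem fderiv_crossRel_sgrad_crossRel (c : Fin 3 → ℝ) :
    fderiv ℝ (crossRel lam s) x (sgrad lam (fun y => c ⬝ᵥ crossRel lam s y) x) =
      c ⨯₃ crossBracket lam s x := by
  obtain ⟨hV₀, hV₁, hU₀, hU₁, hU₂⟩ := hx.coordinate_relations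
  rw [sgrad_dotProduct_crossRel, fderiv_crossRel, dmomentum_hamiltonianOp, om_hamiltonianOp_two,
    al_hamiltonianOp, be_hamiltonianOp, Matrix.vec3_dotProduct]
  refine vec3_ext ?_ ?_ ?_ <;>
    simp only [crossBracket, momentum, shiftAl, shiftBe, tau, cross_apply, Pi.add_apply,
      Pi.sub_apply, Pi.smul_apply, smul_eq_mul, Matrix.cons_val] <;> grind

theorem poissonBracket_dotRel :
    poissonBracket lam (fun y => dotRel lam s y 0) (fun y => dotRel lam s y 1) x =
      s * (momentum lam x ⬝ᵥ tau lam s x) := by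
  obtain ⟨-, -, hU₀, hU₁, hU₂⟩ := hx.coordinate_relations
  rw [poissonBracket, sgrad_dotRel_one, fderiv_dotRel_zero, dmomentum_hamiltonianOp,
    al_hamiltonianOp]
  simp only [momentum, shiftAl, shiftBe, tau, cross_apply, Matrix.vec3_dotProduct, Pi.add_apply,
    map_zero, Pi.zero_apply, Matrix.cons_val]
  grind

theorem fderiv_crossRel_sgrad_H : fderiv ℝ (crossRel lam s) x (sgrad lam H x) = 0 := by
  obtain ⟨hV₀, hV₁, hU₀, hU₁, hU₂⟩ := hx.coordinate_relations
  rw [sgrad_H, fderiv_crossRel, dmomentum_hamiltonianOp, om_hamiltonianOp_two,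
    al_hamiltonianOp, be_hamiltonianOp]
  refine vec3_ext ?_ ?_ ?_ <;>
    simp only [momentum, shiftAl, shiftBe, cross_apply, Pi.add_apply, Pi.sub_apply,
      Pi.smul_apply, Pi.zero_apply, smul_eq_mul, Matrix.cons_val] <;> grind

theorem poissonBracket_dotRel_H (j : Fin 2) :
    poissonBracket lam (fun y => dotRel lam s y j) H x = 0 := by
  obtain ⟨-, -, hU₀, hU₁, -⟩ := hx.coordinate_relations
  fin_cases j
  · change fderiv ℝ (fun y => dotRel lam s y 0) x _ = 0
    rw [sgrad_H, fderiv_dotRel_zero, dmomentum_hamiltonianOp, al_hamiltonianOp]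
    simp only [momentum, shiftAl, cross_apply, Matrix.vec3_dotProduct, Pi.add_apply,
      Matrix.cons_val]
    grind
  · change fderiv ℝ (fun y => dotRel lam s y 1) x _ = 0
    rw [sgrad_H, fderiv_dotRel_one, dmomentum_hamiltonianOp, be_hamiltonianOp]
    simp only [momentum, shiftBe, cross_apply, Matrix.vec3_dotProduct, Pi.add_apply,
      Matrix.cons_val]
    grind

end IsCriticalPair

end Brackets

section TraceIdentity

variable {a b lam s : ℝ} {x : State}

namespace IsCriticalPair

variable (hx : IsCriticalPair a b lam s x)

include hx

theorem crossBracket_dot_self :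
    crossBracket lam s x ⬝ᵥ crossBracket lam s x =
      s ^ 4 * ((om x 2 - lam) ^ 2 * (tau lam s x ⬝ᵥ tau lam s x) / 4
        - s * (om x 2 - lam) ^ 2 * (om x 0 ^ 2 + om x 1 ^ 2)
        + (om x 0 ^ 2 * (shiftAl s x ⬝ᵥ shiftAl s x) + om x 1 ^ 2 * (shiftBe s x ⬝ᵥ shiftBe s x)
          + 2 * om x 0 * om x 1 * (shiftAl s x ⬝ᵥ shiftBe s x))) := by
  simp only [crossBracket, sub_dotProduct, dotProduct_sub, add_dotProduct, dotProduct_add,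
    smul_dotProduct, dotProduct_smul, smul_eq_mul, dotProduct_comm (tau lam s x) (shiftAl s x),
    dotProduct_comm (tau lam s x) (shiftBe s x), dotProduct_comm (shiftBe s x) (shiftAl s x),
    hx.shiftAl_dot_tau, hx.shiftBe_dot_tau]
  ring

theorem mixedBracket_zero_dot_self :
    mixedBracket lam s x 0 ⬝ᵥ mixedBracket lam s x 0 =
      s ^ 4 * om x 1 ^ 2 * (momentum lam x ⬝ᵥ momentum lam x)
        + 4 * s ^ 3 * om x 1 * (om x 0 * (shiftAl s x ⬝ᵥ shiftBe s x)
          - om x 1 * (shiftAl s x ⬝ᵥ shiftAl s x))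
        + s ^ 2 * ((shiftAl s x ⬝ᵥ shiftAl s x) * (tau lam s x ⬝ᵥ tau lam s x)
          - s ^ 2 * (om x 2 - lam) ^ 2 * om x 0 ^ 2) := by
  have htriple : momentum lam x ⬝ᵥ shiftAl s x ⨯₃ tau lam s x =
      -2 * (om x 0 * (shiftAl s x ⬝ᵥ shiftBe s x) - om x 1 * (shiftAl s x ⬝ᵥ shiftAl s x)) := by
    rw [triple_product_permutation, ← cross_anticomm, dotProduct_neg, hx.momentum_cross_tau]
    simp only [dotProduct_smul, dotProduct_sub, smul_eq_mul]
    ring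
  simp only [mixedBracket, Matrix.cons_val, sub_dotProduct, dotProduct_sub, smul_dotProduct,
    dotProduct_smul, smul_eq_mul, cross_dot_cross, dotProduct_comm _ (momentum lam x), htriple,
    dotProduct_comm (tau lam s x) (shiftAl s x), hx.shiftAl_dot_tau]
  ring

theorem mixedBracket_one_dot_self :
    mixedBracket lam s x 1 ⬝ᵥ mixedBracket lam s x 1 =
      s ^ 4 * om x 0 ^ 2 * (momentum lam x ⬝ᵥ momentum lam x)
        - 4 * s ^ 3 * om x 0 * (om x 0 * (shiftBe s x ⬝ᵥ shiftBe s x)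
          - om x 1 * (shiftAl s x ⬝ᵥ shiftBe s x))
        + s ^ 2 * ((shiftBe s x ⬝ᵥ shiftBe s x) * (tau lam s x ⬝ᵥ tau lam s x)
          - s ^ 2 * (om x 2 - lam) ^ 2 * om x 1 ^ 2) := by
  have htriple : momentum lam x ⬝ᵥ shiftBe s x ⨯₃ tau lam s x =
      -2 * (om x 0 * (shiftBe s x ⬝ᵥ shiftBe s x) - om x 1 * (shiftAl s x ⬝ᵥ shiftBe s x)) := by
    rw [triple_product_permutation, ← cross_anticomm, dotProduct_neg, hx.momentum_cross_tau]
    simp only [dotProduct_smul, dotProduct_sub, smul_eq_mul, dotProduct_comm _ (shiftBe s x)]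
    ring
  simp only [mixedBracket, Matrix.cons_val, sub_dotProduct, dotProduct_sub, smul_dotProduct,
    dotProduct_smul, smul_eq_mul, cross_dot_cross, dotProduct_comm _ (momentum lam x), htriple,
    dotProduct_comm (tau lam s x) (shiftBe s x), hx.shiftBe_dot_tau]
  ring

theorem momentum_dot_tau_sq :
    (momentum lam x ⬝ᵥ tau lam s x) ^ 2 =
      (momentum lam x ⬝ᵥ momentum lam x) * (tau lam s x ⬝ᵥ tau lam s x)
        - 4 * (om x 0 ^ 2 * (shiftBe s x ⬝ᵥ shiftBe s x)
          + om x 1 ^ 2 * (shiftAl s x ⬝ᵥ shiftAl s x)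
          - 2 * om x 0 * om x 1 * (shiftAl s x ⬝ᵥ shiftBe s x)) := by
  have hnorm := cross_dot_cross (momentum lam x) (tau lam s x) (momentum lam x) (tau lam s x)
  rw [hx.momentum_cross_tau, dotProduct_comm (tau lam s x) (momentum lam x)] at hnorm
  simp only [sub_dotProduct, dotProduct_sub, smul_dotProduct, dotProduct_smul, smul_eq_mul,
    dotProduct_comm (shiftBe s x) (shiftAl s x)] at hnorm
  linear_combination hnorm

theorem sum_brackets_eq :
    -8 * (crossBracket lam s x ⬝ᵥ crossBracket lam s x)
        + 4 * s * ∑ j, mixedBracket lam s x j ⬝ᵥ mixedBracket lam s x j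
        - 2 * s ^ 2 * (s * (momentum lam x ⬝ᵥ tau lam s x)) ^ 2 =
      s * (cuspFactor a b lam s (H x) * tangencyFactor a b lam s (H x)) := by
  rw [Fin.sum_univ_two, mul_pow s, hx.crossBracket_dot_self, hx.mixedBracket_zero_dot_self,
    hx.mixedBracket_one_dot_self, hx.momentum_dot_tau_sq, hx.cuspFactor_eq,
    tangencyFactor_eq (s := s) hx.mem_phaseSpace]
  ring

end IsCriticalPair

end TraceIdentity

section Casimirs

variable {a b lam : ℝ} {n : WithTop ℕ∞} {x v : State}

/-- The Casimir functions of the Lie-Poisson bracket, normalized to vanish on the phase space. -/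
def casimir (a b : ℝ) : Fin 3 → State → ℝ :=
  ![fun y => al y ⬝ᵥ al y - a ^ 2, fun y => be y ⬝ᵥ be y - b ^ 2, fun y => al y ⬝ᵥ be y]

theorem contDiff_casimir (a b : ℝ) (i : Fin 3) : ContDiff ℝ n (casimir a b i) := by
  fin_cases i
  · exact (contDiff_dotProduct contDiff_al contDiff_al).sub contDiff_const
  · exact (contDiff_dotProduct contDiff_be contDiff_be).sub contDiff_const
  · exact contDiff_dotProduct contDiff_al contDiff_be

theorem casimir_eq_zero (hx : x ∈ phaseSpace a b) (i : Fin 3) : casimir a b i x = 0 := by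
  obtain ⟨hα, hβ, hαβ⟩ := mem_phaseSpace_iff.1 hx
  fin_cases i
  · exact sub_eq_zero.2 hα
  · exact sub_eq_zero.2 hβ
  · exact hαβ

theorem fderiv_al_dotProduct_be (x v : State) :
    fderiv ℝ (fun y => al y ⬝ᵥ be y) x v = be x ⬝ᵥ al v + al x ⬝ᵥ be v := by
  rw [fderiv_dotProduct (contDiff_al.differentiable one_ne_zero x)
    (contDiff_be.differentiable one_ne_zero x), fderiv_al, fderiv_be, dotProduct_comm (al v)]

theorem fderiv_al_dotProduct_self (x v : State) :
    fderiv ℝ (fun y => al y ⬝ᵥ al y) x v = 2 * (al x ⬝ᵥ al v) := by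
  have hα := contDiff_al.differentiable one_ne_zero x
  rw [fderiv_dotProduct hα hα, fderiv_al, dotProduct_comm, two_mul]

theorem fderiv_be_dotProduct_self (x v : State) :
    fderiv ℝ (fun y => be y ⬝ᵥ be y) x v = 2 * (be x ⬝ᵥ be v) := by
  have hβ := contDiff_be.differentiable one_ne_zero x
  rw [fderiv_dotProduct hβ hβ, fderiv_be, dotProduct_comm, two_mul]

theorem fderiv_geom (x v : State) :
    fderiv ℝ geom x v =
      (2 * (al x ⬝ᵥ al v), 2 * (be x ⬝ᵥ be v), be x ⬝ᵥ al v + al x ⬝ᵥ be v) := by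
  have hα : Differentiable ℝ fun y => al y ⬝ᵥ al y :=
    (contDiff_dotProduct contDiff_al contDiff_al).differentiable one_ne_zero
  have hβ : Differentiable ℝ fun y => be y ⬝ᵥ be y :=
    (contDiff_dotProduct contDiff_be contDiff_be).differentiable one_ne_zero
  have hαβ : Differentiable ℝ fun y => al y ⬝ᵥ be y :=
    (contDiff_dotProduct contDiff_al contDiff_be).differentiable one_ne_zero
  change fderiv ℝ (fun y => (al y ⬝ᵥ al y, be y ⬝ᵥ be y, al y ⬝ᵥ be y)) x v = _
  rw [(hα x).fderiv_prodMk ((hβ x).prodMk (hαβ x)), (hβ x).fderiv_prodMk (hαβ x),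
    ContinuousLinearMap.prod_apply, ContinuousLinearMap.prod_apply, fderiv_al_dotProduct_self,
    fderiv_be_dotProduct_self, fderiv_al_dotProduct_be]

theorem mem_tangent_iff :
    v ∈ tangent x ↔
      al x ⬝ᵥ al v = 0 ∧ be x ⬝ᵥ be v = 0 ∧ be x ⬝ᵥ al v + al x ⬝ᵥ be v = 0 := by
  change fderiv ℝ geom x v = 0 ↔ _
  simp only [fderiv_geom, Prod.mk_eq_zero, mul_eq_zero, two_ne_zero, false_or]

theorem fderiv_casimir_eq_zero (hv : v ∈ tangent x) (i : Fin 3) :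
    fderiv ℝ (casimir a b i) x v = 0 := by
  obtain ⟨hα, hβ, hαβ⟩ := mem_tangent_iff.1 hv
  fin_cases i
  · change fderiv ℝ (fun y => al y ⬝ᵥ al y - a ^ 2) x v = 0
    rw [fderiv_sub_const, fderiv_al_dotProduct_self, hα, mul_zero]
  · change fderiv ℝ (fun y => be y ⬝ᵥ be y - b ^ 2) x v = 0
    rw [fderiv_sub_const, fderiv_be_dotProduct_self, hβ, mul_zero]
  · exact (fderiv_al_dotProduct_be x v).trans hαβ

theorem sgrad_mem_tangent (F : State → ℝ) : sgrad lam F x ∈ tangent x := by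
  refine mem_tangent_iff.2 ⟨dot_self_cross _ _, dot_self_cross _ _, ?_⟩
  change be x ⬝ᵥ al x ⨯₃ gradM F x + al x ⬝ᵥ be x ⨯₃ gradM F x = 0
  rw [triple_product_permutation, ← dotProduct_add, cross_anticomm', dotProduct_zero]

theorem hamiltonianOp_zero_left {ξ η : Fin 3 → ℝ} (h : al x ⨯₃ ξ + be x ⨯₃ η = 0) :
    hamiltonianOp lam x 0 ξ η = 0 := by
  have hm : momentum lam x ⨯₃ 0 + al x ⨯₃ ξ + be x ⨯₃ η = 0 := by rw [map_zero, zero_add, h]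
  refine Prod.ext ?_ (Prod.ext (map_zero _) (map_zero _))
  simp only [hamiltonianOp, hm]
  exact vec3_ext (zero_div 2) (zero_div 2) rfl

theorem sgrad_casimir (a b : ℝ) (i : Fin 3) : sgrad lam (casimir a b i) x = 0 := by
  fin_cases i
  · refine (sgrad_eq_hamiltonianOp (u := 0) (ξ := (2 : ℝ) • al x) (η := 0) fun v => ?_).trans
      (hamiltonianOp_zero_left (by simp))
    change fderiv ℝ (fun y => al y ⬝ᵥ al y - a ^ 2) x v = _
    simp [fderiv_sub_const, fderiv_al_dotProduct_self]
  · refine (sgrad_eq_hamiltonianOp (u := 0) (ξ := 0) (η := (2 : ℝ) • be x) fun v => ?_).trans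
      (hamiltonianOp_zero_left (by simp))
    change fderiv ℝ (fun y => be y ⬝ᵥ be y - b ^ 2) x v = _
    simp [fderiv_sub_const, fderiv_be_dotProduct_self]
  · refine (sgrad_eq_hamiltonianOp (u := 0) (ξ := be x) (η := al x) fun v => ?_).trans
      (hamiltonianOp_zero_left (cross_anticomm' _ _))
    rw [zero_dotProduct, zero_add]
    exact fderiv_al_dotProduct_be x v

end Casimirs

section RelationFamily

variable {a b lam s h : ℝ} {n : WithTop ℕ∞} {x : State}

/-- The defining functions of the first critical subsystem on the energy level `h`. -/
def relation (lam s h : ℝ) : Option (Fin 3 ⊕ Fin 2) → State → ℝ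
  | none => fun y => H y - h
  | some (.inl i) => fun y => crossRel lam s y i
  | some (.inr j) => fun y => dotRel lam s y j

/-- Twice the coefficients of the squares of the functions `relation` in
`s * criticalIntegral`. -/
def relationWeight (s : ℝ) : Option (Fin 3 ⊕ Fin 2) → ℝ
  | none => 2 * s ^ 2
  | some (.inl _) => -2
  | some (.inr _) => s

/-- The combination `s (K - (2h - λ² - 2s) H) + 2 G`, critical on the first critical subsystem at
the points with the value `s` of `S₁` on the energy level `h`. -/
def criticalIntegral (a b lam s h : ℝ) : State → ℝ :=
  integral a b lam (-2 * s * (h - lam ^ 2 / 2 - s)) s 2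

theorem contDiff_K (lam : ℝ) : ContDiff ℝ n (K lam) := by
  have hω (i : Fin 3) := contDiff_om_apply (n := n) i
  have hα (i : Fin 3) := contDiff_al_apply (n := n) i
  have hβ (i : Fin 3) := contDiff_be_apply (n := n) i
  unfold K
  fun_prop

theorem contDiff_G (a b lam : ℝ) : ContDiff ℝ n (G a b lam) := by
  have hω := contDiff_om_apply (n := n) 2
  have hα := contDiff_al_apply (n := n) 0
  have hβ := contDiff_be_apply (n := n) 1
  have hMα := contDiff_dotProduct (contDiff_momentum (n := n) lam) contDiff_al
  have hMβ := contDiff_dotProduct (contDiff_momentum (n := n) lam) contDiff_be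
  have hMγ := contDiff_dotProduct (contDiff_momentum (n := n) lam)
    (contDiff_crossProduct contDiff_al contDiff_be)
  unfold G
  fun_prop

theorem contDiff_integral (a b lam cH cK cG : ℝ) : ContDiff ℝ n (integral a b lam cH cK cG) :=
  ((contDiff_const.mul contDiff_H).add (contDiff_const.mul (contDiff_K lam))).add
    (contDiff_const.mul (contDiff_G a b lam))

theorem contDiff_criticalIntegral (a b lam s h : ℝ) :
    ContDiff ℝ n (criticalIntegral a b lam s h) :=
  contDiff_integral ..

theorem contDiff_relation (lam s h : ℝ) (i : Option (Fin 3 ⊕ Fin 2)) :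
    ContDiff ℝ n (relation lam s h i) :=
  match i with
  | none => contDiff_H.sub contDiff_const
  | some (.inl i) => contDiff_pi.1 (contDiff_crossRel lam s) i
  | some (.inr j) => contDiff_pi.1 (contDiff_dotRel lam s) j

theorem IsCriticalPair.relation_eq_zero (hx : IsCriticalPair a b lam s x)
    (i : Option (Fin 3 ⊕ Fin 2)) : relation lam s (H x) i x = 0 :=
  match i with
  | none => sub_self _
  | some (.inl i) => congrFun hx.crossRel_eq_zero i
  | some (.inr j) => congrFun hx.dotRel_eq_zero j

/-- The multipliers of the Casimir functions in `s * criticalIntegral`. -/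
def casimirMultiplier (a s : ℝ) : Fin 3 → State → ℝ
  | 0 => fun y => s ^ 2 + 2 * s * be y 1 + be y ⬝ᵥ be y
  | 1 => fun y => s ^ 2 + 2 * s * al y 0 + a ^ 2
  | 2 => fun y => -(2 * s * (al y 1 + be y 0) + al y ⬝ᵥ be y)

theorem contDiff_casimirMultiplier (a s : ℝ) (i : Fin 3) :
    ContDiff ℝ n (casimirMultiplier a s i) := by
  have hα (i : Fin 3) := contDiff_al_apply (n := n) i
  have hβ (i : Fin 3) := contDiff_be_apply (n := n) i
  have hαβ := contDiff_dotProduct (n := n) contDiff_al contDiff_be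
  have hββ := contDiff_dotProduct (n := n) contDiff_be contDiff_be
  match i with
  | 0 => unfold casimirMultiplier; fun_prop
  | 1 => unfold casimirMultiplier; fun_prop
  | 2 => unfold casimirMultiplier; fun_prop

theorem mul_criticalIntegral (a b lam s h : ℝ) (y : State) :
    s * criticalIntegral a b lam s h y =
      s ^ 2 * (lam ^ 4 / 4 + s * lam ^ 2 - h ^ 2 + s ^ 2 + pSq a b) + a ^ 2 * b ^ 2
        + (∑ i, relationWeight s i / 2 * relation lam s h i y * relation lam s h i y
          + ∑ i, casimirMultiplier a s i y * casimir a b i y) := by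
  simp only [Fintype.sum_option, Fintype.sum_sum_type, Fin.sum_univ_three, Fin.sum_univ_two,
    relationWeight, relation, casimir, casimirMultiplier, criticalIntegral, integral,
    Matrix.cons_val]
  have hK := sq_mul_K a b lam s y
  have hG := mul_G a b lam s y
  rw [Matrix.vec3_dotProduct (crossRel lam s y)] at hK hG
  linear_combination hK + 2 * hG

/-- The multipliers of the functions `relation` in `s ^ 2 * K`. -/
def multiplierK (lam s h : ℝ) : Option (Fin 3 ⊕ Fin 2) → State → ℝ
  | none => fun y => s ^ 2 * (H y + h - lam ^ 2 - 4 * s)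
  | some (.inl i) => fun y => 2 * s * tau lam s y i + crossRel lam s y i
  | some (.inr j) => fun y => 2 * s ^ 2 * om y j.castSucc

theorem contDiff_multiplierK (lam s h : ℝ) (i : Option (Fin 3 ⊕ Fin 2)) :
    ContDiff ℝ n (multiplierK lam s h i) := by
  have hω (i : Fin 3) := contDiff_om_apply (n := n) i
  have hα (i : Fin 3) := contDiff_al_apply (n := n) i
  have hβ (i : Fin 3) := contDiff_be_apply (n := n) i
  have hH := contDiff_H (n := n)
  have hU (i : Fin 3) : ContDiff ℝ n fun y => crossRel lam s y i :=
    contDiff_pi.1 (contDiff_crossRel lam s) i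
  rcases i with - | i | j
  · unfold multiplierK; fun_prop
  · have hτ : ContDiff ℝ n fun y => tau lam s y i := by
      fin_cases i <;> simp only [tau, Fin.zero_eta, Fin.mk_one, Fin.reduceFinMk, Matrix.cons_val]
        <;> fun_prop
    unfold multiplierK; fun_prop
  · unfold multiplierK; fun_prop

/-- The multipliers of the Casimir functions in `s ^ 2 * K`. -/
def casimirMultiplierK (a s : ℝ) : Fin 3 → State → ℝ
  | 0 => fun y => s ^ 2 - be y ⬝ᵥ be y
  | 1 => fun _ => s ^ 2 - a ^ 2
  | 2 => fun y => al y ⬝ᵥ be y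

theorem contDiff_casimirMultiplierK (a s : ℝ) (i : Fin 3) :
    ContDiff ℝ n (casimirMultiplierK a s i) :=
  match i with
  | 0 => contDiff_const.sub (contDiff_dotProduct contDiff_be contDiff_be)
  | 1 => contDiff_const
  | 2 => contDiff_dotProduct contDiff_al contDiff_be

theorem sq_mul_K_eq (a b lam s h : ℝ) (y : State) :
    s ^ 2 * K lam y =
      s ^ 2 * (pSq a b + (h - lam ^ 2 / 2) ^ 2 - 4 * (h - lam ^ 2 / 2) * s + 3 * s ^ 2)
        - a ^ 2 * b ^ 2
        + (∑ i, multiplierK lam s h i y * relation lam s h i y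
          + ∑ i, casimirMultiplierK a s i y * casimir a b i y) := by
  simp only [Fintype.sum_option, Fintype.sum_sum_type, Fin.sum_univ_three, Fin.sum_univ_two,
    multiplierK, relation, casimir, casimirMultiplierK, Fin.castSucc_zero, Fin.castSucc_one,
    Matrix.cons_val]
  have hK := sq_mul_K a b lam s y
  rw [Matrix.vec3_dotProduct, Matrix.vec3_dotProduct (crossRel lam s y)] at hK
  linear_combination hK

end RelationFamily

section Ideal

variable {ι : Type*} [Fintype ι] {a b lam c k : ℝ} {x v : State} {F : State → ℝ}
  {P W : ι → State → ℝ} {R : Fin 3 → State → ℝ}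

theorem mul_fderiv_eq_sum_of_mem_tangent (hF : Differentiable ℝ F)
    (hP : ∀ i, Differentiable ℝ (P i)) (hW : ∀ i, Differentiable ℝ (W i))
    (hR : ∀ i, Differentiable ℝ (R i))
    (h : ∀ y, c * F y = k + (∑ i, P i y * W i y + ∑ i, R i y * casimir a b i y))
    (hx : x ∈ phaseSpace a b) (hWx : ∀ i, W i x = 0) (hv : v ∈ tangent x) :
    c * fderiv ℝ F x v = ∑ i, P i x * fderiv ℝ (W i) x v := by
  have hC (i : Fin 3) : Differentiable ℝ (casimir a b i) :=
    (contDiff_casimir a b i).differentiable one_ne_zero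
  have hPW := fun i (_ : i ∈ Finset.univ) => (hP i x).fun_mul (hW i x)
  have hRC := fun i (_ : i ∈ Finset.univ) => (hR i x).fun_mul (hC i x)
  have hderiv := congrArg (fun f => fderiv ℝ f x v) (funext h)
  rw [fderiv_const_mul (hF x), fderiv_const_add, fderiv_fun_add (.fun_sum hPW) (.fun_sum hRC),
    fderiv_fun_sum hPW, fderiv_fun_sum hRC] at hderiv
  simpa only [fderiv_fun_mul (hP _ x) (hW _ x), fderiv_fun_mul (hR _ x) (hC _ x), hWx,
    casimir_eq_zero hx, fderiv_casimir_eq_zero hv, add_apply, sum_apply, smul_apply, smul_eq_mul,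
    zero_mul, mul_zero, add_zero, Finset.sum_const_zero] using hderiv

theorem smul_fderiv_sgrad_eq_sum_of_mem_tangent (hF : ContDiff ℝ 2 F)
    (hP : ∀ i, ContDiff ℝ 2 (P i)) (hW : ∀ i, ContDiff ℝ 2 (W i)) (hR : ∀ i, ContDiff ℝ 2 (R i))
    (h : ∀ y, c * F y = k + (∑ i, P i y * W i y + ∑ i, R i y * casimir a b i y))
    (hx : x ∈ phaseSpace a b) (hWx : ∀ i, W i x = 0) (hv : v ∈ tangent x) :
    c • fderiv ℝ (sgrad lam F) x v =
      ∑ i, (fderiv ℝ (P i) x v • sgrad lam (W i) x + P i x • fderiv ℝ (sgrad lam (W i)) x v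
        + fderiv ℝ (W i) x v • sgrad lam (P i) x) := by
  have hC := contDiff_casimir (n := 2) a b
  have hC' (i : Fin 3) : sgrad lam (casimir a b i) = 0 := funext fun y => sgrad_casimir a b i
  rw [fderiv_sgrad_of_const_mul_eq_add_sum_mul (P := Sum.elim P R) (Q := Sum.elim W (casimir a b))
    hF (Sum.forall.2 ⟨hP, hR⟩) (Sum.forall.2 ⟨hW, hC⟩)
    (by simpa only [Fintype.sum_sum_type, Sum.elim_inl, Sum.elim_inr] using h)]
  simp only [Fintype.sum_sum_type, Sum.elim_inl, Sum.elim_inr, fderiv_sgrad_mul (hP _) (hW _),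
    fderiv_sgrad_mul (hR _) (hC _), hWx, casimir_eq_zero hx, fderiv_casimir_eq_zero hv, hC',
    Pi.zero_apply, fderiv_zero, smul_zero, zero_smul, add_zero, zero_apply, Finset.sum_const_zero]

end Ideal

section Linearization

variable {a b lam s : ℝ} {x v : State}

namespace IsCriticalPair

variable (hx : IsCriticalPair a b lam s x)

include hx

theorem fderiv_criticalIntegral_eq_zero (hs : s ≠ 0) (hv : v ∈ tangent x) :
    fderiv ℝ (criticalIntegral a b lam s (H x)) x v = 0 := by
  have hW (i) := (contDiff_relation (n := 1) lam s (H x) i).differentiable one_ne_zero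
  have hsum := mul_fderiv_eq_sum_of_mem_tangent
    ((contDiff_criticalIntegral a b lam s (H x)).differentiable one_ne_zero)
    (fun i => (hW i).const_mul (relationWeight s i / 2)) hW
    (fun i => (contDiff_casimirMultiplier a s i).differentiable one_ne_zero)
    (mul_criticalIntegral a b lam s (H x)) hx.mem_phaseSpace hx.relation_eq_zero hv
  simpa only [hx.relation_eq_zero, mul_zero, zero_mul, Finset.sum_const_zero, mul_eq_zero, hs,
    false_or] using hsum

theorem smul_fderiv_sgrad_criticalIntegral (hv : v ∈ tangent x) :
    s • fderiv ℝ (sgrad lam (criticalIntegral a b lam s (H x))) x v =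
      ∑ i, relationWeight s i •
        fderiv ℝ (relation lam s (H x) i) x v • sgrad lam (relation lam s (H x) i) x := by
  have hW := contDiff_relation (n := 2) lam s (H x)
  have hWd (i) := (hW i).differentiable two_ne_zero x
  rw [smul_fderiv_sgrad_eq_sum_of_mem_tangent (contDiff_criticalIntegral a b lam s (H x))
    (fun i => contDiff_const.mul (hW i)) hW (contDiff_casimirMultiplier a s)
    (mul_criticalIntegral a b lam s (H x)) hx.mem_phaseSpace hx.relation_eq_zero hv]
  refine Finset.sum_congr rfl fun i _ => ?_
  rw [fderiv_const_mul (hWd i), sgrad_const_mul _ (hWd i), hx.relation_eq_zero, smul_apply]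
  module

theorem sq_mul_fderiv_K (hv : v ∈ tangent x) :
    s ^ 2 * fderiv ℝ (K lam) x v =
      ∑ i, multiplierK lam s (H x) i x * fderiv ℝ (relation lam s (H x) i) x v :=
  mul_fderiv_eq_sum_of_mem_tangent ((contDiff_K lam).differentiable one_ne_zero)
    (fun i => (contDiff_multiplierK lam s (H x) i).differentiable one_ne_zero)
    (fun i => (contDiff_relation lam s (H x) i).differentiable one_ne_zero)
    (fun i => (contDiff_casimirMultiplierK a s i).differentiable one_ne_zero)
    (sq_mul_K_eq a b lam s (H x)) hx.mem_phaseSpace hx.relation_eq_zero hv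

end IsCriticalPair

end Linearization

section RelationBrackets

variable {a b lam s h : ℝ} {x : State}

theorem sgrad_relation_none : sgrad lam (relation lam s h none) x = sgrad lam H x :=
  sgrad_eq_hamiltonianOp fun v => by rw [← fderiv_eq_grad, relation, fderiv_sub_const]

theorem poissonBracket_relation_inl (F : State → ℝ) (i : Fin 3) :
    poissonBracket lam (relation lam s h (some (.inl i))) F x =
      fderiv ℝ (crossRel lam s) x (sgrad lam F x) i := by
  rw [poissonBracket, relation,
    fderiv_apply ((contDiff_crossRel lam s).differentiable one_ne_zero x) i]
  rfl

theorem relation_inl_eq_dotProduct (i : Fin 3) :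
    relation lam s h (some (.inl i)) = fun y => Pi.single i 1 ⬝ᵥ crossRel lam s y :=
  funext fun y => (single_one_dotProduct i (crossRel lam s y)).symm

theorem crossBracket_cross_tau (lam s : ℝ) (x : State) :
    crossBracket lam s x ⨯₃ tau lam s x =
      s • (om x 0 • mixedBracket lam s x 0 + om x 1 • mixedBracket lam s x 1) := by
  simp only [crossBracket, mixedBracket, map_sub, map_add, map_smul, LinearMap.sub_apply,
    LinearMap.add_apply, LinearMap.smul_apply, cross_self, Matrix.cons_val]
  module

theorem tau_dot_mixedBracket_zero (lam s : ℝ) (x : State) :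
    tau lam s x ⬝ᵥ mixedBracket lam s x 0 =
      s ^ 2 * om x 1 * (momentum lam x ⬝ᵥ tau lam s x) := by
  simp only [mixedBracket, Matrix.cons_val, dotProduct_sub, dotProduct_smul, dot_cross_self,
    dotProduct_comm (tau lam s x) (momentum lam x), smul_eq_mul, mul_zero, sub_zero]

theorem tau_dot_mixedBracket_one (lam s : ℝ) (x : State) :
    tau lam s x ⬝ᵥ mixedBracket lam s x 1 =
      -(s ^ 2 * om x 0) * (momentum lam x ⬝ᵥ tau lam s x) := by
  simp only [mixedBracket, Matrix.cons_val, dotProduct_sub, dotProduct_smul, dot_cross_self,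
    dotProduct_comm (tau lam s x) (momentum lam x), smul_eq_mul, mul_zero, sub_zero]

namespace IsCriticalPair

variable (hx : IsCriticalPair a b lam s x)

include hx

theorem poissonBracket_relation_none (i : Option (Fin 3 ⊕ Fin 2)) :
    poissonBracket lam (relation lam s h i) (relation lam s h none) x = 0 :=
  match i with
  | none => poissonBracket_self ..
  | some (.inl i) => by
    rw [poissonBracket_relation_inl, sgrad_relation_none, hx.fderiv_crossRel_sgrad_H,
      Pi.zero_apply]
  | some (.inr j) => by
    rw [poissonBracket, sgrad_relation_none]
    exact hx.poissonBracket_dotRel_H j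

theorem poissonBracket_none_relation (i : Option (Fin 3 ⊕ Fin 2)) :
    poissonBracket lam (relation lam s h none) (relation lam s h i) x = 0 := by
  rw [poissonBracket_comm, hx.poissonBracket_relation_none, neg_zero]

theorem poissonBracket_inl_inl (i j : Fin 3) :
    poissonBracket lam (relation lam s h (some (.inl i))) (relation lam s h (some (.inl j))) x =
      (Pi.single j 1 ⨯₃ crossBracket lam s x) i := by
  rw [poissonBracket_relation_inl, relation_inl_eq_dotProduct j,
    hx.fderiv_crossRel_sgrad_crossRel]

theorem poissonBracket_inl_inr (i : Fin 3) (j : Fin 2) :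
    poissonBracket lam (relation lam s h (some (.inl i))) (relation lam s h (some (.inr j))) x =
      mixedBracket lam s x j i := by
  rw [poissonBracket_relation_inl, ← hx.fderiv_crossRel_sgrad_dotRel j]
  rfl

theorem poissonBracket_inr_inl (i : Fin 3) (j : Fin 2) :
    poissonBracket lam (relation lam s h (some (.inr j))) (relation lam s h (some (.inl i))) x =
      -mixedBracket lam s x j i := by
  rw [poissonBracket_comm, hx.poissonBracket_inl_inr]

theorem poissonBracket_inr_zero_inr_one :
    poissonBracket lam (relation lam s h (some (.inr 0))) (relation lam s h (some (.inr 1))) x =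
      s * (momentum lam x ⬝ᵥ tau lam s x) :=
  hx.poissonBracket_dotRel

theorem poissonBracket_inr_one_inr_zero :
    poissonBracket lam (relation lam s h (some (.inr 1))) (relation lam s h (some (.inr 0))) x =
      -(s * (momentum lam x ⬝ᵥ tau lam s x)) := by
  rw [poissonBracket_comm, hx.poissonBracket_inr_zero_inr_one]

theorem sum_poissonBracket_relation_mul :
    ∑ i, ∑ j, relationWeight s i * relationWeight s j *
        (poissonBracket lam (relation lam s h i) (relation lam s h j) x *
          poissonBracket lam (relation lam s h j) (relation lam s h i) x) =
      s * (cuspFactor a b lam s (H x) * tangencyFactor a b lam s (H x)) := by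
  rw [← hx.sum_brackets_eq]
  simp only [Fintype.sum_option, Fintype.sum_sum_type, hx.poissonBracket_relation_none,
    hx.poissonBracket_none_relation, hx.poissonBracket_inl_inl, hx.poissonBracket_inl_inr,
    hx.poissonBracket_inr_inl, Fin.sum_univ_two, poissonBracket_self,
    hx.poissonBracket_inr_one_inr_zero, hx.poissonBracket_inr_zero_inr_one, relationWeight,
    Fin.sum_univ_three, Matrix.vec3_dotProduct, cross_apply, Matrix.cons_val, Pi.single_apply,
    Fin.isValue, Fin.reduceEq, if_true, if_false]
  ring

theorem poissonBracket_K_relation (hs : s ≠ 0) (i : Option (Fin 3 ⊕ Fin 2)) :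
    poissonBracket lam (K lam) (relation lam s (H x) i) x = 0 := by
  have hU (m : Fin 3) : crossRel lam s x m = 0 := congrFun hx.crossRel_eq_zero m
  have hsum := hx.sq_mul_fderiv_K (sgrad_mem_tangent (lam := lam) (relation lam s (H x) i))
  change s ^ 2 * poissonBracket lam (K lam) _ x =
    ∑ m, multiplierK lam s (H x) m x * poissonBracket lam (relation lam s (H x) m) _ x at hsum
  refine (mul_eq_zero.1 (hsum.trans ?_)).resolve_left (pow_ne_zero 2 hs)
  simp only [Fintype.sum_option, Fintype.sum_sum_type, multiplierK, hU, add_zero]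
  match i with
  | none => simp only [hx.poissonBracket_relation_none, mul_zero, Finset.sum_const_zero, add_zero]
  | some (.inl i) =>
    have hτ : tau lam s x ⬝ᵥ (Pi.single i 1 ⨯₃ crossBracket lam s x) =
        s * (om x 0 * mixedBracket lam s x 0 i + om x 1 * mixedBracket lam s x 1 i) := by
      rw [triple_product_permutation, single_one_dotProduct, crossBracket_cross_tau]
      rfl
    rw [Matrix.vec3_dotProduct] at hτ
    simp only [hx.poissonBracket_none_relation, hx.poissonBracket_inl_inl,
      hx.poissonBracket_inr_inl, Fin.sum_univ_three, Fin.sum_univ_two, Fin.castSucc_zero,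
      Fin.castSucc_one]
    linear_combination 2 * s * hτ
  | some (.inr 0) =>
    have hτ := tau_dot_mixedBracket_zero lam s x
    rw [Matrix.vec3_dotProduct (tau lam s x)] at hτ
    simp only [hx.poissonBracket_none_relation, hx.poissonBracket_inl_inr, Fin.sum_univ_three,
      Fin.sum_univ_two, Fin.castSucc_zero, Fin.castSucc_one, poissonBracket_self,
      hx.poissonBracket_inr_one_inr_zero]
    linear_combination 2 * s * hτ
  | some (.inr 1) =>
    have hτ := tau_dot_mixedBracket_one lam s x
    rw [Matrix.vec3_dotProduct (tau lam s x)] at hτ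
    simp only [hx.poissonBracket_none_relation, hx.poissonBracket_inl_inr, Fin.sum_univ_three,
      Fin.sum_univ_two, Fin.castSucc_zero, Fin.castSucc_one, poissonBracket_self,
      hx.poissonBracket_inr_zero_inr_one]
    linear_combination 2 * s * hτ

end IsCriticalPair

end RelationBrackets

section LinearAlgebra

open Module Polynomial

variable {k V W : Type*} [Field k] [AddCommGroup V] [Module k V] [AddCommGroup W]
  [Module k W]

theorem mkQ_comp_liftQ {A : End k V} {N : Submodule k V} (hN : N ≤ LinearMap.ker A) :
    N.mkQ ∘ₗ N.liftQ A hN = N.mapQ N A (hN.trans (LinearMap.ker_le_comap A)) :=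
  N.linearMap_qext rfl

variable [FiniteDimensional k V] [FiniteDimensional k W]

theorem charpoly_comp_comm_of_le (f : V →ₗ[k] W) (g : W →ₗ[k] V) (h : finrank k W ≤ finrank k V) :
    (g ∘ₗ f).charpoly = X ^ (finrank k V - finrank k W) * (f ∘ₗ g).charpoly := by
  let bV := finBasis k V
  let bW := finBasis k W
  rw [← LinearMap.charpoly_toMatrix _ bV, ← LinearMap.charpoly_toMatrix _ bW,
    LinearMap.toMatrix_comp bV bW bV, LinearMap.toMatrix_comp bW bV bW,
    Matrix.charpoly_mul_comm_of_le _ _ (by simpa only [Fintype.card_fin] using h),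
    Fintype.card_fin, Fintype.card_fin]

theorem charpoly_eq_X_pow_mul_restrict {A : End k V} {R : Submodule k V} (hR : ∀ v, A v ∈ R) :
    A.charpoly =
      X ^ (finrank k V - finrank k R) * (A.restrict fun v (_ : v ∈ R) => hR v).charpoly :=
  charpoly_comp_comm_of_le (A.codRestrict R hR) R.subtype R.finrank_le

theorem charpoly_eq_X_pow_mul_mapQ {A : End k V} {N : Submodule k V} (hN : N ≤ LinearMap.ker A) :
    A.charpoly = X ^ finrank k N *
      (N.mapQ N A (hN.trans (LinearMap.ker_le_comap A))).charpoly := by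
  have hdim := N.finrank_quotient_add_finrank
  have h := charpoly_comp_comm_of_le N.mkQ (N.liftQ A hN) (by lia)
  rwa [N.liftQ_mkQ, mkQ_comp_liftQ, ← hdim, Nat.add_sub_cancel_left] at h

theorem trace_mapQ_of_le_ker {A : End k V} {N : Submodule k V} (hN : N ≤ LinearMap.ker A) :
    LinearMap.trace k _ (N.mapQ N A (hN.trans (LinearMap.ker_le_comap A))) =
      LinearMap.trace k V A := by
  rw [← mkQ_comp_liftQ hN, LinearMap.trace_comp_comm', N.liftQ_mkQ]

theorem charpoly_eq_of_finrank_eq_two [NeZero (2 : k)] (hV : finrank k V = 2) {A : End k V}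
    (hA : LinearMap.trace k V A = 0) :
    A.charpoly = X ^ 2 - C (LinearMap.trace k V (A ∘ₗ A) / 2) := by
  let b := finBasisOfFinrankEq k V hV
  rw [LinearMap.trace_eq_matrix_trace k b] at hA ⊢
  have hdet : (LinearMap.toMatrix b b (A ∘ₗ A)).trace / 2 = -(LinearMap.toMatrix b b A).det := by
    rw [Matrix.trace_fin_two] at hA
    rw [LinearMap.toMatrix_comp b b b, Matrix.trace_fin_two, Matrix.det_fin_two,
      div_eq_iff two_ne_zero, Matrix.mul_apply, Matrix.mul_apply, Fin.sum_univ_two,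
      Fin.sum_univ_two, eq_neg_of_add_eq_zero_left hA]
    ring
  rw [← LinearMap.charpoly_toMatrix A b, Matrix.charpoly_fin_two, hA, hdet, C_0, C_neg, zero_mul,
    sub_zero, sub_neg_eq_add]

theorem charpoly_eq_of_flag [NeZero (2 : k)] {A : End k V} {N R : Submodule k V} (hNR : N ≤ R)
    (hN : N ≤ LinearMap.ker A) (hR : ∀ v, A v ∈ R) (hdim : finrank k R = finrank k N + 2)
    (hA : LinearMap.trace k V A = 0) :
    A.charpoly = X ^ (finrank k V - 2) * (X ^ 2 - C (LinearMap.trace k V (A ∘ₗ A) / 2)) := by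
  let B : End k R := A.restrict fun v _ => hR v
  let N' : Submodule k R := N.submoduleOf R
  have hN' : finrank k N' = finrank k N := (Submodule.submoduleOfEquivOfLe hNR).finrank_eq
  have hB : N' ≤ LinearMap.ker B := fun v hv => Subtype.ext (hN hv)
  have hBB : N' ≤ LinearMap.ker (B ∘ₗ B) := hB.trans (LinearMap.ker_le_ker_comp B B)
  have hQ : finrank k (R ⧸ N') = 2 := by
    have := N'.finrank_quotient_add_finrank
    lia
  have htr : LinearMap.trace k _ (N'.mapQ N' B (hB.trans (LinearMap.ker_le_comap B))) = 0 := by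
    rw [trace_mapQ_of_le_ker hB, ← hA]
    exact LinearMap.trace_restrict_eq_of_forall_mem R A hR
  have htr₂ : LinearMap.trace k _ (N'.mapQ N' (B ∘ₗ B) (hBB.trans (LinearMap.ker_le_comap _))) =
      LinearMap.trace k V (A ∘ₗ A) := by
    rw [trace_mapQ_of_le_ker hBB]
    exact LinearMap.trace_restrict_eq_of_forall_mem R (A ∘ₗ A) fun v => hR (A v)
  rw [charpoly_eq_X_pow_mul_restrict hR, charpoly_eq_X_pow_mul_mapQ hB,
    charpoly_eq_of_finrank_eq_two hQ htr, ← Submodule.mapQ_comp, htr₂, hN', ← mul_assoc,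
    ← pow_add]
  congr 2
  have := R.finrank_le
  lia

theorem trace_sum_smulRight {ι : Type*} [Fintype ι] (f : ι → V →ₗ[k] k) (w : ι → V) :
    LinearMap.trace k V (∑ i, (f i).smulRight (w i)) = ∑ i, f i (w i) := by
  rw [map_sum]
  exact Finset.sum_congr rfl fun i _ => LinearMap.trace_smulRight (f i) (w i)

theorem trace_sum_smulRight_comp_self {ι : Type*} [Fintype ι] (f : ι → V →ₗ[k] k) (w : ι → V) :
    LinearMap.trace k V ((∑ i, (f i).smulRight (w i)) ∘ₗ ∑ i, (f i).smulRight (w i)) =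
      ∑ i, ∑ j, f i (w j) * f j (w i) := by
  have hcomp (B : V →ₗ[k] V) :
      (∑ i, (f i).smulRight (w i)) ∘ₗ B = ∑ i, (f i ∘ₗ B).smulRight (w i) := by
    ext v
    simp only [LinearMap.comp_apply, LinearMap.sum_apply, LinearMap.smulRight_apply]
  rw [hcomp, trace_sum_smulRight]
  simp only [LinearMap.comp_apply, LinearMap.sum_apply, LinearMap.smulRight_apply, map_sum,
    map_smul, smul_eq_mul, mul_comm]

end LinearAlgebra

section OrthogonalFrame

theorem cross_dot_cross_mul_dot {R : Type*} [CommRing R] (u v p q : Fin 3 → R) :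
    (u ⨯₃ v ⬝ᵥ u ⨯₃ v) * (p ⬝ᵥ q) =
      (p ⬝ᵥ u ⨯₃ v) * (q ⬝ᵥ u ⨯₃ v) + (v ⬝ᵥ v) * ((p ⬝ᵥ u) * (q ⬝ᵥ u))
        + (u ⬝ᵥ u) * ((p ⬝ᵥ v) * (q ⬝ᵥ v))
        - (u ⬝ᵥ v) * ((p ⬝ᵥ u) * (q ⬝ᵥ v) + (p ⬝ᵥ v) * (q ⬝ᵥ u)) := by
  simp only [Matrix.vec3_dotProduct, cross_apply, Matrix.cons_val]
  ring

variable {k : Type*} [Field k] {u v : Fin 3 → k}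

theorem eq_zero_of_cross_eq_zero_of_dot_eq_zero {w : Fin 3 → k} (huv : u ⬝ᵥ v ≠ 0)
    (huw : u ⨯₃ w = 0) (hvw : v ⬝ᵥ w = 0) : w = 0 := by
  have h := cross_cross_eq_smul_sub_smul' v u w
  rw [huw, map_zero, hvw, zero_smul, zero_sub, zero_eq_neg] at h
  exact (smul_eq_zero.1 h).resolve_left huv

theorem eq_zero_of_cross_eq_zero (hu : u ⬝ᵥ u ≠ 0) (hv : v ⬝ᵥ v ≠ 0) (huv : u ⬝ᵥ v = 0)
    {w : Fin 3 → k} (huw : u ⨯₃ w = 0) (hvw : v ⨯₃ w = 0) : w = 0 := by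
  refine eq_zero_of_cross_eq_zero_of_dot_eq_zero hv hvw ?_
  have h := cross_cross_eq_smul_sub_smul' u u w
  rw [huw, map_zero, eq_comm, sub_eq_zero] at h
  have hvu := congrArg (v ⬝ᵥ ·) h
  simp only [dotProduct_smul, smul_eq_mul, dotProduct_comm v u, huv, mul_zero] at hvu
  exact (mul_eq_zero.1 hvu.symm).resolve_left hu

theorem dot_add_dot_eq_zero_of_cross_add_cross_eq_zero (hu : u ⬝ᵥ u ≠ 0) (hv : v ⬝ᵥ v ≠ 0)
    (huv : u ⬝ᵥ v = 0) {ξ η p q : Fin 3 → k} (h : u ⨯₃ ξ + v ⨯₃ η = 0) (hup : u ⬝ᵥ p = 0)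
    (hvq : v ⬝ᵥ q = 0) (hpq : v ⬝ᵥ p + u ⬝ᵥ q = 0) : ξ ⬝ᵥ p + η ⬝ᵥ q = 0 := by
  have hξ : ξ ⬝ᵥ u ⨯₃ v = 0 := by
    have := congrArg (v ⬝ᵥ ·) h
    rw [← neg_eq_zero, ← dotProduct_neg, cross_anticomm]
    simpa only [dotProduct_add, cross_self, add_zero, dotProduct_zero,
      triple_product_permutation v, triple_product_permutation u] using this
  have hη : η ⬝ᵥ u ⨯₃ v = 0 := by
    have := congrArg (u ⬝ᵥ ·) h
    simpa only [dotProduct_add, dot_self_cross, zero_add, dotProduct_zero,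
      triple_product_permutation η] using this
  have hmixed : (u ⬝ᵥ u) * (ξ ⬝ᵥ v) = (v ⬝ᵥ v) * (η ⬝ᵥ u) := by
    have := congrArg (u ⨯₃ v ⬝ᵥ ·) h
    simp only [dotProduct_add, cross_dot_cross, dotProduct_zero, huv, dotProduct_comm v u] at this
    linear_combination this + (u ⬝ᵥ u) * dotProduct_comm ξ v - (v ⬝ᵥ v) * dotProduct_comm η u
  have hγ : u ⨯₃ v ⬝ᵥ u ⨯₃ v = (u ⬝ᵥ u) * (v ⬝ᵥ v) := by
    rw [cross_dot_cross, huv, zero_mul, sub_zero]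
  have hp := cross_dot_cross_mul_dot u v ξ p
  have hq := cross_dot_cross_mul_dot u v η q
  rw [hγ, dotProduct_comm p u, dotProduct_comm p v, hξ, hup, huv] at hp
  rw [hγ, dotProduct_comm q u, dotProduct_comm q v, hη, hvq, huv] at hq
  refine (mul_eq_zero.1 ?_).resolve_left (mul_ne_zero hu hv)
  linear_combination hp + hq + (u ⬝ᵥ u) * (ξ ⬝ᵥ v) * hpq - (u ⬝ᵥ q) * hmixed

end OrthogonalFrame

section PhaseSpace

variable {a b lam : ℝ} {x : State}

theorem fderiv_eq_zero_of_sgrad_eq_zero (ha : a ≠ 0) (hb : b ≠ 0) (hx : x ∈ phaseSpace a b)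
    {F : State → ℝ} (hF : sgrad lam F x = 0) {v : State} (hv : v ∈ tangent x) :
    fderiv ℝ F x v = 0 := by
  obtain ⟨hα, hβ, hαβ⟩ := mem_phaseSpace_iff.1 hx
  obtain ⟨hαv, hβv, hαβv⟩ := mem_tangent_iff.1 hv
  have hα₀ : al x ⬝ᵥ al x ≠ 0 := hα ▸ pow_ne_zero 2 ha
  have hβ₀ : be x ⬝ᵥ be x ≠ 0 := hβ ▸ pow_ne_zero 2 hb
  have hM : gradM F x = 0 :=
    eq_zero_of_cross_eq_zero hα₀ hβ₀ hαβ (congrArg al hF) (congrArg be hF)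
  have hrate : al x ⨯₃ gradAl F x + be x ⨯₃ gradBe F x = 0 := by
    have h := dmomentum_sgrad (lam := lam) (x := x) F
    rw [hF, momentumRate, hM, map_zero, zero_add] at h
    rw [← h]
    exact vec3_ext (mul_zero 2) (mul_zero 2) rfl
  rw [fderiv_eq_grad, hM, zero_dotProduct, zero_add]
  exact dot_add_dot_eq_zero_of_cross_add_cross_eq_zero hα₀ hβ₀ hαβ hrate hαv hβv hαβv

theorem range_fderiv_geom (ha : a ≠ 0) (hb : b ≠ 0) (hx : x ∈ phaseSpace a b) :
    LinearMap.range (fderiv ℝ geom x : State →ₗ[ℝ] ℝ × ℝ × ℝ) = ⊤ := by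
  obtain ⟨hα, hβ, hαβ⟩ := mem_phaseSpace_iff.1 hx
  refine LinearMap.range_eq_top.2 fun ⟨p, q, r⟩ =>
    ⟨(0, (p / (2 * a ^ 2)) • al x, (q / (2 * b ^ 2)) • be x + (r / a ^ 2) • al x), ?_⟩
  refine (fderiv_geom x _).trans ?_
  change (2 * (al x ⬝ᵥ (p / (2 * a ^ 2)) • al x),
    2 * (be x ⬝ᵥ ((q / (2 * b ^ 2)) • be x + (r / a ^ 2) • al x)),
    be x ⬝ᵥ (p / (2 * a ^ 2)) • al x +
      al x ⬝ᵥ ((q / (2 * b ^ 2)) • be x + (r / a ^ 2) • al x)) = (p, q, r)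
  simp only [dotProduct_add, dotProduct_smul, dotProduct_comm (be x) (al x), hα, hβ, hαβ,
    smul_eq_mul, mul_zero, add_zero, zero_add]
  refine Prod.ext ?_ (Prod.ext ?_ ?_) <;> dsimp only <;> field_simp

theorem finrank_tangent (ha : a ≠ 0) (hb : b ≠ 0) (hx : x ∈ phaseSpace a b) :
    Module.finrank ℝ (tangent x) = 6 := by
  have h := LinearMap.finrank_range_add_finrank_ker (fderiv ℝ geom x : State →ₗ[ℝ] ℝ × ℝ × ℝ)
  rw [range_fderiv_geom ha hb hx, finrank_top] at h
  simp only [State, Module.finrank_prod, Module.finrank_self, Module.finrank_fin_fun] at h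
  rw [tangent]
  lia

end PhaseSpace

section RankTwo

variable {a b lam cH cK cH' cK' cG' : ℝ} {x v : State}

theorem fderiv_J (a b lam : ℝ) (x v : State) :
    fderiv ℝ (J a b lam) x v =
      (fderiv ℝ H x v, fderiv ℝ (K lam) x v, fderiv ℝ (G a b lam) x v) := by
  have hH := contDiff_H.differentiable one_ne_zero x
  have hK := (contDiff_K lam).differentiable one_ne_zero x
  have hG := (contDiff_G a b lam).differentiable one_ne_zero x
  change fderiv ℝ (fun y => (H y, K lam y, G a b lam y)) x v = _
  rw [hH.fderiv_prodMk (hK.prodMk hG), hK.fderiv_prodMk hG]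
  rfl

theorem fderiv_integral (a b lam cH cK cG : ℝ) (x v : State) :
    fderiv ℝ (integral a b lam cH cK cG) x v =
      cH * fderiv ℝ H x v + cK * fderiv ℝ (K lam) x v + cG * fderiv ℝ (G a b lam) x v := by
  have hH := contDiff_H.differentiable one_ne_zero x
  have hK := (contDiff_K lam).differentiable one_ne_zero x
  have hG := (contDiff_G a b lam).differentiable one_ne_zero x
  change fderiv ℝ (fun y => cH * H y + cK * K lam y + cG * G a b lam y) x v = _
  rw [fderiv_fun_add ((hH.const_mul cH).fun_add (hK.const_mul cK)) (hG.const_mul cG),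
    fderiv_fun_add (hH.const_mul cH) (hK.const_mul cK), fderiv_const_mul hH,
    fderiv_const_mul hK, fderiv_const_mul hG]
  rfl

theorem surjective_fderiv_H_K (hr : rank a b lam x = 2)
    (hcrit : ∀ v ∈ tangent x, fderiv ℝ (integral a b lam cH cK 2) x v = 0) :
    Function.Surjective
      (((fderiv ℝ H x).prod (fderiv ℝ (K lam) x) : State →ₗ[ℝ] ℝ × ℝ).domRestrict (tangent x)) := by
  let dJ : State →ₗ[ℝ] ℝ × ℝ × ℝ := fderiv ℝ (J a b lam) x
  let forgetG : ℝ × ℝ × ℝ →ₗ[ℝ] ℝ × ℝ := LinearMap.prodMap LinearMap.id (LinearMap.fst ℝ ℝ ℝ)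
  let R := (tangent x).map dJ
  have hinj : Function.Injective (forgetG.domRestrict R) := by
    rw [← LinearMap.ker_eq_bot, LinearMap.ker_eq_bot']
    rintro ⟨_, v, hv, rfl⟩ hpv
    have hJ : dJ v = _ := fderiv_J a b lam x v
    have hcritv := hcrit v hv
    rw [fderiv_integral] at hcritv
    obtain ⟨hH, hK⟩ : fderiv ℝ H x v = 0 ∧ fderiv ℝ (K lam) x v = 0 :=
      Prod.mk_eq_zero.1 ((congrArg forgetG hJ).symm.trans hpv)
    have hG : fderiv ℝ (G a b lam) x v = 0 := by
      simpa only [hH, hK, mul_zero, zero_add, mul_eq_zero, two_ne_zero, false_or] using hcritv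
    exact Subtype.ext (hJ.trans (by rw [hH, hK, hG]; rfl))
  have hsurj : LinearMap.range (forgetG.domRestrict R) = ⊤ := by
    refine Submodule.eq_top_of_finrank_eq ?_
    rw [LinearMap.finrank_range_of_inj hinj, Module.finrank_prod, Module.finrank_self]
    exact hr
  intro p
  obtain ⟨⟨_, v, hv, rfl⟩, hp⟩ := LinearMap.range_eq_top.1 hsurj p
  exact ⟨⟨v, hv⟩, (congrArg forgetG (fderiv_J a b lam x v)).symm.trans hp⟩

theorem integral_coeffs_of_critical (hr : rank a b lam x = 2)
    (hcrit : ∀ v ∈ tangent x, fderiv ℝ (integral a b lam cH cK 2) x v = 0)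
    (hcrit' : ∀ v ∈ tangent x, fderiv ℝ (integral a b lam cH' cK' cG') x v = 0) :
    cH' = cG' / 2 * cH ∧ cK' = cG' / 2 * cK := by
  have hcomb (p : ℝ × ℝ) : (cH' - cG' / 2 * cH) * p.1 + (cK' - cG' / 2 * cK) * p.2 = 0 := by
    obtain ⟨v, rfl⟩ := surjective_fderiv_H_K hr hcrit p
    have h := hcrit v v.2
    have h' := hcrit' v v.2
    rw [fderiv_integral] at h h'
    change (cH' - cG' / 2 * cH) * fderiv ℝ H x v + (cK' - cG' / 2 * cK) * fderiv ℝ (K lam) x v = 0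
    linear_combination h' - cG' / 2 * h
  exact ⟨by linear_combination hcomb (1, 0), by linear_combination hcomb (0, 1)⟩

end RankTwo

section SumOfSquares

variable {ι : Type*} [Fintype ι] {a b lam : ℝ} {E F : State → ℝ} {c : ι → ℝ} {W : ι → State → ℝ}
  {x : State}

/-- The linearization, at a common zero of the functions `W i`, of the Hamiltonian field of the
quadratic form `∑ i, c i * W i ^ 2 / 2`. -/
def sumSqLinearization (lam : ℝ) (c : ι → ℝ) (W : ι → State → ℝ) (x : State) :
    tangent x →ₗ[ℝ] tangent x :=
  ∑ i, (c i • (fderiv ℝ (W i) x : State →ₗ[ℝ] ℝ).domRestrict (tangent x)).smulRight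
    ⟨sgrad lam (W i) x, sgrad_mem_tangent (W i)⟩

theorem coe_sumSqLinearization (v : tangent x) :
    (sumSqLinearization lam c W x v : State) =
      ∑ i, c i • fderiv ℝ (W i) x v • sgrad lam (W i) x := by
  simp only [sumSqLinearization, LinearMap.sum_apply, LinearMap.smulRight_apply,
    Submodule.coe_sum, Submodule.coe_smul, smul_assoc, LinearMap.smul_apply]
  rfl

theorem trace_sumSqLinearization :
    LinearMap.trace ℝ (tangent x) (sumSqLinearization lam c W x) = 0 :=
  (trace_sum_smulRight ..).trans <| Finset.sum_eq_zero fun i _ =>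
    mul_eq_zero_of_right (c i) (poissonBracket_self lam (W i) x)

theorem trace_sumSqLinearization_comp_self :
    LinearMap.trace ℝ (tangent x)
        (sumSqLinearization lam c W x ∘ₗ sumSqLinearization lam c W x) =
      ∑ i, ∑ j, c i * c j *
        (poissonBracket lam (W i) (W j) x * poissonBracket lam (W j) (W i) x) :=
  (trace_sum_smulRight_comp_self ..).trans <| Finset.sum_congr rfl fun i _ =>
    Finset.sum_congr rfl fun j _ => mul_mul_mul_comm (c i) _ (c j) _

theorem fderiv_sumSqLinearization (hF : ∀ i, poissonBracket lam F (W i) x = 0) (v : tangent x) :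
    fderiv ℝ F x (sumSqLinearization lam c W x v) = 0 := by
  rw [coe_sumSqLinearization, map_sum]
  refine Finset.sum_eq_zero fun i _ => ?_
  rw [map_smul, map_smul, show fderiv ℝ F x (sgrad lam (W i) x) = 0 from hF i, smul_zero,
    smul_zero]

theorem sumSqLinearization_sgrad (hF : ∀ i, poissonBracket lam F (W i) x = 0) :
    sumSqLinearization lam c W x ⟨sgrad lam F x, sgrad_mem_tangent F⟩ = 0 := by
  refine Subtype.ext ((coe_sumSqLinearization _).trans (Finset.sum_eq_zero fun i _ => ?_))
  have hWF : fderiv ℝ (W i) x (sgrad lam F x) = 0 :=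
    (poissonBracket_comm lam (W i) F x).trans (by rw [hF, neg_zero])
  rw [hWF, zero_smul, smul_zero]

theorem linearIndependent_sgrad (ha : a ≠ 0) (hb : b ≠ 0) (hx : x ∈ phaseSpace a b)
    (hE : DifferentiableAt ℝ E x) (hF : DifferentiableAt ℝ F x)
    (hEF : Function.Surjective
      (((fderiv ℝ E x).prod (fderiv ℝ F x) : State →ₗ[ℝ] ℝ × ℝ).domRestrict (tangent x))) :
    LinearIndependent ℝ ![(⟨sgrad lam E x, sgrad_mem_tangent E⟩ : tangent x),
      ⟨sgrad lam F x, sgrad_mem_tangent F⟩] := by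
  refine LinearIndependent.pair_iff.2 fun p q hpq => ?_
  have hsgrad : sgrad lam (fun y => p * E y + q * F y) x = 0 := by
    rw [sgrad_add (hE.const_mul p) (hF.const_mul q), sgrad_const_mul p hE, sgrad_const_mul q hF]
    exact congrArg Subtype.val hpq
  have hcomb (r : ℝ × ℝ) : p * r.1 + q * r.2 = 0 := by
    obtain ⟨v, rfl⟩ := hEF r
    have h := fderiv_eq_zero_of_sgrad_eq_zero ha hb hx hsgrad v.2
    rw [fderiv_fun_add (hE.const_mul p) (hF.const_mul q), fderiv_const_mul hE,
      fderiv_const_mul hF] at h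
    exact h
  exact ⟨by linear_combination hcomb (1, 0), by linear_combination hcomb (0, 1)⟩

theorem charpoly_sumSqLinearization (ha : a ≠ 0) (hb : b ≠ 0) (hx : x ∈ phaseSpace a b)
    (hE : DifferentiableAt ℝ E x) (hF : DifferentiableAt ℝ F x)
    (hEF : Function.Surjective
      (((fderiv ℝ E x).prod (fderiv ℝ F x) : State →ₗ[ℝ] ℝ × ℝ).domRestrict (tangent x)))
    (hEF₀ : poissonBracket lam E F x = 0) (hEW : ∀ i, poissonBracket lam E (W i) x = 0)
    (hFW : ∀ i, poissonBracket lam F (W i) x = 0) :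
    (sumSqLinearization lam c W x).charpoly =
      Polynomial.X ^ 4 * (Polynomial.X ^ 2 - Polynomial.C ((∑ i, ∑ j, c i * c j *
        (poissonBracket lam (W i) (W j) x * poissonBracket lam (W j) (W i) x)) / 2)) := by
  let dEF := ((fderiv ℝ E x).prod (fderiv ℝ F x) : State →ₗ[ℝ] ℝ × ℝ).domRestrict (tangent x)
  let XE : tangent x := ⟨sgrad lam E x, sgrad_mem_tangent E⟩
  let XF : tangent x := ⟨sgrad lam F x, sgrad_mem_tangent F⟩
  let N := Submodule.span ℝ (Set.range ![XE, XF])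
  have hN : Module.finrank ℝ N = 2 :=
    finrank_span_eq_card (linearIndependent_sgrad ha hb hx hE hF hEF)
  have hNR : N ≤ LinearMap.ker dEF := Submodule.span_le.2 <| Set.range_subset_iff.2 <|
    Fin.forall_fin_two.2 ⟨Prod.ext (poissonBracket_self lam E x)
      ((poissonBracket_comm lam F E x).trans (by rw [hEF₀, neg_zero]; rfl)),
      Prod.ext hEF₀ (poissonBracket_self lam F x)⟩
  have hNA : N ≤ LinearMap.ker (sumSqLinearization lam c W x) :=
    Submodule.span_le.2 <| Set.range_subset_iff.2 <| Fin.forall_fin_two.2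
      ⟨sumSqLinearization_sgrad hEW, sumSqLinearization_sgrad hFW⟩
  have hAR (v : tangent x) : sumSqLinearization lam c W x v ∈ LinearMap.ker dEF :=
    Prod.ext (fderiv_sumSqLinearization hEW v) (fderiv_sumSqLinearization hFW v)
  have hR : Module.finrank ℝ (LinearMap.ker dEF) = Module.finrank ℝ N + 2 := by
    have h := LinearMap.finrank_range_add_finrank_ker dEF
    rw [LinearMap.range_eq_top.2 hEF, finrank_top, Module.finrank_prod, Module.finrank_self,
      finrank_tangent ha hb hx] at h
    omega
  rw [charpoly_eq_of_flag hNR hNA hAR hR trace_sumSqLinearization,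
    trace_sumSqLinearization_comp_self, finrank_tangent ha hb hx]

end SumOfSquares

section Exponent

theorem HasSquaredExponent.unique {lam c c' : ℝ} {F : State → ℝ} {x : State}
    (h : HasSquaredExponent lam F x c) (h' : HasSquaredExponent lam F x c') : c = c' := by
  obtain ⟨-, A, hA, hAc⟩ := h
  obtain ⟨-, A', hA', hAc'⟩ := h'
  obtain rfl : A = A' := LinearMap.ext fun v => Subtype.ext ((hA v).trans (hA' v).symm)
  have h := mul_left_cancel₀ (pow_ne_zero 4 Polynomial.X_ne_zero) (hAc.symm.trans hAc')
  exact Polynomial.C_injective (sub_right_injective h)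

theorem integral_mul (a b lam t cH cK cG : ℝ) :
    integral a b lam (t * cH) (t * cK) (t * cG) = fun y => t * integral a b lam cH cK cG y :=
  funext fun y => by simp only [integral]; ring

namespace IsCriticalPair

variable {a b lam s : ℝ} {x : State} (ha : a ≠ 0) (hb : b ≠ 0) (hx : IsCriticalPair a b lam s x)

include hx

theorem poissonBracket_H_relation (i : Option (Fin 3 ⊕ Fin 2)) :
    poissonBracket lam H (relation lam s (H x) i) x = 0 := by
  rw [poissonBracket_comm, poissonBracket, ← sgrad_relation_none (s := s) (h := H x)]
  exact neg_eq_zero.2 (hx.poissonBracket_relation_none i)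

theorem poissonBracket_H_K (hs : s ≠ 0) : poissonBracket lam H (K lam) x = 0 := by
  have hsum := hx.sq_mul_fderiv_K (sgrad_mem_tangent (lam := lam) H)
  have hzero (i) : fderiv ℝ (relation lam s (H x) i) x (sgrad lam H x) = 0 :=
    (poissonBracket_comm lam _ H x).trans (by rw [hx.poissonBracket_H_relation, neg_zero])
  simp only [hzero, mul_zero, Finset.sum_const_zero] at hsum
  rw [poissonBracket_comm, neg_eq_zero]
  exact (mul_eq_zero.1 hsum).resolve_left (pow_ne_zero 2 hs)

theorem fderiv_sgrad_mul_criticalIntegral (hs : s ≠ 0) (t : ℝ) (v : tangent x) :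
    (sumSqLinearization lam (fun i => t * s⁻¹ * relationWeight s i) (relation lam s (H x)) x v :
      State) = fderiv ℝ (sgrad lam fun y => t * criticalIntegral a b lam s (H x) y) x v := by
  have hF := contDiff_criticalIntegral (n := 2) a b lam s (H x)
  have hsgrad : (sgrad lam fun y => t * criticalIntegral a b lam s (H x) y) =
      fun y => t • sgrad lam (criticalIntegral a b lam s (H x)) y :=
    funext fun y => sgrad_const_mul t (hF.differentiable two_ne_zero y)
  rw [hsgrad, fderiv_fun_const_smul (differentiable_sgrad hF x), smul_apply,
    ← inv_smul_smul₀ hs (fderiv ℝ _ x (v : State)), hx.smul_fderiv_sgrad_criticalIntegral v.2,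
    coe_sumSqLinearization, smul_smul, Finset.smul_sum]
  simp only [smul_smul, mul_assoc]

include ha hb

theorem hasSquaredExponent_mul_criticalIntegral (hr : rank a b lam x = 2) (t : ℝ) :
    HasSquaredExponent lam (fun y => t * criticalIntegral a b lam s (H x) y) x
      (t ^ 2 * muSq a b lam s (H x)) := by
  have hs := hx.ne_zero ha hb
  have hcrit (v) (hv : v ∈ tangent x) := hx.fderiv_criticalIntegral_eq_zero hs hv
  refine ⟨fun v hv => ?_, _, hx.fderiv_sgrad_mul_criticalIntegral hs t, ?_⟩
  · rw [fderiv_const_mul ((contDiff_criticalIntegral a b lam s (H x)).differentiable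
      one_ne_zero x), smul_apply, hcrit v hv, smul_zero]
  · rw [charpoly_sumSqLinearization ha hb hx.mem_phaseSpace
      (contDiff_H.differentiable one_ne_zero x) ((contDiff_K lam).differentiable one_ne_zero x)
      (surjective_fderiv_H_K hr hcrit) (hx.poissonBracket_H_K hs) hx.poissonBracket_H_relation
      (hx.poissonBracket_K_relation hs)]
    congr 3
    calc (∑ i, ∑ j, _) / 2
        = (t * s⁻¹) ^ 2 / 2 * ∑ i, ∑ j, relationWeight s i * relationWeight s j *
            (poissonBracket lam (relation lam s (H x) i) (relation lam s (H x) j) x *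
              poissonBracket lam (relation lam s (H x) j) (relation lam s (H x) i) x) := by
          simp only [Finset.mul_sum, Finset.sum_div]
          exact Finset.sum_congr rfl fun i _ => Finset.sum_congr rfl fun j _ => by ring
      _ = t ^ 2 * muSq a b lam s (H x) := by
          rw [hx.sum_poissonBracket_relation_mul, muSq_eq]
          field_simp

theorem exists_eq_sq_mul_muSq (hr : rank a b lam x = 2) {cH cK cG c : ℝ}
    (h : HasSquaredExponent lam (integral a b lam cH cK cG) x c) :
    ∃ t : ℝ, c = t ^ 2 * muSq a b lam s (H x) := by
  have hcrit (v) (hv : v ∈ tangent x) := hx.fderiv_criticalIntegral_eq_zero (hx.ne_zero ha hb) hv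
  obtain ⟨rfl, rfl⟩ := integral_coeffs_of_critical hr hcrit h.1
  obtain ⟨t, rfl⟩ : ∃ t, cG = t * 2 := ⟨cG / 2, (div_mul_cancel₀ cG two_ne_zero).symm⟩
  rw [mul_div_cancel_right₀ t two_ne_zero, integral_mul] at h
  exact ⟨t, h.unique (hx.hasSquaredExponent_mul_criticalIntegral ha hb hr t)⟩

theorem hasSquaredExponent_criticalIntegral (hr : rank a b lam x = 2) :
    HasSquaredExponent lam (criticalIntegral a b lam s (H x)) x (muSq a b lam s (H x)) := by
  simpa only [one_mul, one_pow] using hx.hasSquaredExponent_mul_criticalIntegral ha hb hr 1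

theorem isCenter_iff (hr : rank a b lam x = 2) :
    IsCenter a b lam x ↔ muSq a b lam s (H x) < 0 := by
  refine ⟨?_, fun h => ⟨hr, _, _, _, _, h, hx.hasSquaredExponent_criticalIntegral ha hb hr⟩⟩
  rintro ⟨-, cH, cK, cG, c, hc, hF⟩
  obtain ⟨t, rfl⟩ := hx.exists_eq_sq_mul_muSq ha hb hr hF
  exact neg_of_mul_neg_right hc (sq_nonneg t)

theorem isSaddle_iff (hr : rank a b lam x = 2) :
    IsSaddle a b lam x ↔ 0 < muSq a b lam s (H x) := by
  refine ⟨?_, fun h => ⟨hr, _, _, _, _, h, hx.hasSquaredExponent_criticalIntegral ha hb hr⟩⟩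
  rintro ⟨-, cH, cK, cG, c, hc, hF⟩
  obtain ⟨t, rfl⟩ := hx.exists_eq_sq_mul_muSq ha hb hr hF
  exact pos_of_mul_pos_right hc (sq_nonneg t)

theorem isDegenerate_iff (hr : rank a b lam x = 2) :
    IsDegenerate a b lam x ↔ muSq a b lam s (H x) = 0 := by
  refine ⟨fun h => ?_, fun h => ⟨hr, ?_⟩⟩
  · by_contra hμ
    exact h.2 ⟨_, _, _, _, hμ, hx.hasSquaredExponent_criticalIntegral ha hb hr⟩
  · rintro ⟨cH, cK, cG, c, hc, hF⟩
    obtain ⟨t, rfl⟩ := hx.exists_eq_sq_mul_muSq ha hb hr hF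
    exact hc (mul_eq_zero_of_right _ h)

end IsCriticalPair

end Exponent

section CriticalSubsystem

variable {a b lam s : ℝ} {x : State}

theorem num_im (lam : ℝ) (x : State) : (num lam x).im = 0 := by
  simp only [num, x₁, x₂, z₁, z₂, w₁, w₂, w₃, Complex.add_im, Complex.mul_im, Complex.mul_re,
    Complex.add_re, Complex.ofReal_re, Complex.ofReal_im]
  ring

theorem w₁_mul_w₂ (x : State) : w₁ x * w₂ x = ((om x 0 ^ 2 + om x 1 ^ 2 : ℝ) : ℂ) := by
  apply Complex.ext <;>
    simp only [w₁, w₂, Complex.mul_re, Complex.mul_im, Complex.ofReal_re, Complex.ofReal_im] <;>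
    ring

theorem den_eq_ofReal (lam : ℝ) (x : State) :
    den lam x = (((om x 0 ^ 2 + om x 1 ^ 2) * (om x 2 - lam) : ℝ) : ℂ) := by
  rw [den, w₁_mul_w₂, w₃, ← Complex.ofReal_sub, ← Complex.ofReal_mul]

/-- The partial integral `S₁` as a real-valued function. -/
def realS1 (lam : ℝ) (x : State) : ℝ :=
  (num lam x).re / (2 * ((om x 0 ^ 2 + om x 1 ^ 2) * (om x 2 - lam)))

theorem S1_eq_ofReal (lam : ℝ) (x : State) : S1 lam x = (realS1 lam x : ℂ) := by
  have hnum : num lam x = ((num lam x).re : ℂ) := Complex.ext rfl (num_im lam x)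
  rw [S1, den_eq_ofReal, hnum, realS1]
  push_cast
  rfl

theorem relation₁_eq (lam s : ℝ) (x : State) :
    w₂ x * (y₁ x + 2 * s) + x₂ x * w₁ x + z₂ x * (w₃ x + lam) =
      ⟨dotRel lam s x 0, -dotRel lam s x 1⟩ := by
  apply Complex.ext <;>
    simp [dotRel, momentum, shiftAl, shiftBe, x₂, y₁, z₂, w₁, w₂, w₃] <;>
    ring

theorem num_re_sub (lam s : ℝ) (x : State) :
    (num lam x).re - 2 * s * ((om x 0 ^ 2 + om x 1 ^ 2) * (om x 2 - lam)) =
      2 * (om x 0 * crossRel lam s x 0 + om x 1 * crossRel lam s x 1)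
       + al x 2 * dotRel lam s x 0 + be x 2 * dotRel lam s x 1 := by
  simp only [num, crossRel, dotRel, momentum, shiftAl, shiftBe, cross_apply, x₁, x₂, z₁, z₂, w₁,
    w₂, w₃, Complex.add_re, Complex.mul_re, Complex.add_im, Complex.mul_im, Complex.ofReal_re,
    Complex.ofReal_im, Matrix.vec3_dotProduct, Matrix.cons_val, Pi.sub_apply, Pi.smul_apply,
    smul_eq_mul]
  ring

theorem crossRel_eq_zero_of_dotRel_eq_zero (hω : om x 0 ^ 2 + om x 1 ^ 2 ≠ 0)
    (hdot : dotRel lam s x = 0)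
    (h : om x 0 * crossRel lam s x 0 + om x 1 * crossRel lam s x 1 = 0) :
    crossRel lam s x = 0 := by
  refine eq_zero_of_cross_eq_zero_of_dot_eq_zero (u := momentum lam x)
    (v := ![om x 0, om x 1, 0]) ?_ ?_ ?_
  · have hdot_momentum :
        momentum lam x ⬝ᵥ ![om x 0, om x 1, 0] = 2 * (om x 0 ^ 2 + om x 1 ^ 2) := by
      simp only [momentum, Matrix.vec3_dotProduct, Matrix.cons_val]
      ring
    rw [hdot_momentum]
    exact mul_ne_zero two_ne_zero hω
  · simp only [momentum_cross_crossRel, hdot, Pi.zero_apply, zero_smul, sub_zero]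
  · simpa only [Matrix.vec3_dotProduct, Matrix.cons_val, zero_mul, add_zero] using h

theorem dotRel_eq_zero_of_relation₁
    (h : w₂ x * (y₁ x + 2 * s) + x₂ x * w₁ x + z₂ x * (w₃ x + lam) = 0) : dotRel lam s x = 0 := by
  rw [relation₁_eq, Complex.ext_iff] at h
  ext i
  match i with
  | 0 => exact h.1
  | 1 => exact neg_eq_zero.1 h.2

theorem isCriticalPair_realS1 (hx : x ∈ M1gen a b lam) :
    IsCriticalPair a b lam (realS1 lam x) x := by
  obtain ⟨hgeom, hden, hy, -⟩ := hx
  have hS : num lam x = 2 * realS1 lam x * den lam x := by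
    rw [← S1_eq_ofReal, S1]
    field_simp
  have hw : w₁ x * (w₃ x - lam) ≠ 0 := fun h =>
    hden (by rw [den, mul_right_comm, h, zero_mul])
  have hdot : dotRel lam (realS1 lam x) x = 0 := by
    refine dotRel_eq_zero_of_relation₁ ((mul_eq_zero.1 ?_).resolve_left hw)
    have hy' : den lam x * y₁ x =
        -(w₁ x * (w₃ x - lam) * (x₂ x * w₁ x + z₂ x * (w₃ x + lam)) + num lam x) := by
      rw [hy]
      field_simp
    rw [hS, den] at hy'
    linear_combination hy'
  rw [den_eq_ofReal, Complex.ofReal_ne_zero] at hden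
  refine ⟨hgeom, crossRel_eq_zero_of_dotRel_eq_zero (left_ne_zero_of_mul hden) hdot ?_, hdot⟩
  have hN := num_re_sub lam (realS1 lam x) x
  rw [den_eq_ofReal, ← Complex.ofReal_ofNat, ← Complex.ofReal_mul, ← Complex.ofReal_mul] at hS
  rw [hS, Complex.ofReal_re, sub_self, hdot] at hN
  simpa using hN.symm

end CriticalSubsystem

section Limit

open Filter

variable {a b lam s : ℝ} {x : State}

theorem isClosed_isCriticalPair (a b lam : ℝ) :
    IsClosed {p : State × ℝ | IsCriticalPair a b lam p.2 p.1} := by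
  have hα (i : Fin 3) : Continuous fun p : State × ℝ => al p.1 i := by unfold al; fun_prop
  have hβ (i : Fin 3) : Continuous fun p : State × ℝ => be p.1 i := by unfold be; fun_prop
  have hω (i : Fin 3) : Continuous fun p : State × ℝ => om p.1 i := by unfold om; fun_prop
  have hgeom : Continuous fun p : State × ℝ => geom p.1 := by
    simp only [geom, Matrix.vec3_dotProduct]
    fun_prop
  have hcross : Continuous fun p : State × ℝ => crossRel lam p.2 p.1 := by
    simp only [continuous_pi_iff, Fin.forall_fin_succ, IsEmpty.forall_iff, and_true, crossRel,
      shiftAl, shiftBe, momentum, cross_apply, Pi.sub_apply, Pi.smul_apply, smul_eq_mul,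
      Fin.succ_zero_eq_one, Fin.succ_one_eq_two, Matrix.cons_val]
    exact ⟨by fun_prop, by fun_prop, by fun_prop⟩
  have hdot : Continuous fun p : State × ℝ => dotRel lam p.2 p.1 := by
    simp only [continuous_pi_iff, Fin.forall_fin_two, dotRel, shiftAl, shiftBe, momentum,
      Matrix.vec3_dotProduct, Matrix.cons_val]
    exact ⟨by fun_prop, by fun_prop⟩
  have hset : {p : State × ℝ | IsCriticalPair a b lam p.2 p.1} =
      {p | geom p.1 = (a ^ 2, b ^ 2, 0)} ∩
        ({p | crossRel lam p.2 p.1 = 0} ∩ {p | dotRel lam p.2 p.1 = 0}) :=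
    Set.ext fun p => ⟨fun h => ⟨h.1, h.2, h.3⟩, fun h => ⟨h.1, h.2.1, h.2.2⟩⟩
  rw [hset]
  exact (isClosed_eq hgeom continuous_const).inter
    ((isClosed_eq hcross continuous_const).inter (isClosed_eq hdot continuous_const))

theorem abs_le_of_sq_eq_mul_add {s B C : ℝ} (h : s ^ 2 = s * B + C) : |s| ≤ |B| + |C| + 1 := by
  by_contra! hs
  have hB : s * B ≤ |s| * |B| := (le_abs_self _).trans_eq (abs_mul s B)
  nlinarith [le_abs_self C, abs_nonneg B, abs_nonneg C, sq_abs s]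

theorem IsCriticalPair.abs_le (hx : IsCriticalPair a b lam s x) :
    |s| ≤ |(om x 2 ^ 2 - lam ^ 2) / 2 - al x 0 - be x 1| + |-(al x ⨯₃ be x) 2| + 1 := by
  refine abs_le_of_sq_eq_mul_add ?_
  have h : crossRel lam s x 2 = 0 := congrFun hx.crossRel_eq_zero 2
  linear_combination h - crossRel_two lam s x

theorem exists_eventually_abs_realS1_le (a b lam : ℝ) (x : State) :
    ∃ M : ℝ, ∀ᶠ y in 𝓝[M1gen a b lam] x, |realS1 lam y| ≤ M := by
  let bound : State → ℝ := fun y =>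
    |(om y 2 ^ 2 - lam ^ 2) / 2 - al y 0 - be y 1| + |-(al y ⨯₃ be y) 2| + 1
  have hbound : Continuous bound := by
    simp only [bound, om, al, be, cross_apply, Matrix.cons_val]
    fun_prop
  refine ⟨bound x + 1, ?_⟩
  filter_upwards [nhdsWithin_le_nhds (hbound.tendsto x (gt_mem_nhds (lt_add_one _))),
    self_mem_nhdsWithin] with y hy hmem
  exact (isCriticalPair_realS1 hmem).abs_le.trans (le_of_lt hy)

theorem IsCriticalPair.of_mapClusterPt (h : MapClusterPt s (𝓝[M1gen a b lam] x) (realS1 lam)) :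
    IsCriticalPair a b lam s x := by
  obtain ⟨U, hU, hs⟩ := mapClusterPt_iff_ultrafilter.1 h
  have hx : Tendsto id (U : Filter State) (𝓝 x) := hU.trans nhdsWithin_le_nhds
  exact (isClosed_isCriticalPair a b lam).mem_of_tendsto (hx.prodMk_nhds hs)
    (hU (mem_of_superset self_mem_nhdsWithin fun y hy => isCriticalPair_realS1 hy))

theorem IsCriticalPair.unique {s' : ℝ} (ha : a ≠ 0) (hb : b ≠ 0) (hr : rank a b lam x = 2)
    (hs : IsCriticalPair a b lam s x) (hs' : IsCriticalPair a b lam s' x) : s = s' := by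
  have hcrit (v) (hv : v ∈ tangent x) := hs.fderiv_criticalIntegral_eq_zero (hs.ne_zero ha hb) hv
  have hcrit' (v) (hv : v ∈ tangent x) := hs'.fderiv_criticalIntegral_eq_zero (hs'.ne_zero ha hb) hv
  have hK := (integral_coeffs_of_critical hr hcrit hcrit').2
  linear_combination -hK

theorem exists_isS1Value (ha : a ≠ 0) (hb : b ≠ 0) (hr : rank a b lam x = 2)
    (hx : x ∈ M1 a b lam) : ∃ s : ℝ, IsS1Value a b lam x s ∧ IsCriticalPair a b lam s x := by
  have : (𝓝[M1gen a b lam] x).NeBot := mem_closure_iff_nhdsWithin_neBot.1 hx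
  obtain ⟨M, hM⟩ := exists_eventually_abs_realS1_le a b lam x
  have hIcc : ∀ᶠ y in 𝓝[M1gen a b lam] x, realS1 lam y ∈ Set.Icc (-M) M :=
    hM.mono fun y hy => abs_le.1 hy
  obtain ⟨s, -, hs⟩ := isCompact_Icc.exists_clusterPt
    (f := map (realS1 lam) (𝓝[M1gen a b lam] x)) (le_principal_iff.2 hIcc)
  have hpair : IsCriticalPair a b lam s x := .of_mapClusterPt hs
  have hlim : Tendsto (realS1 lam) (𝓝[M1gen a b lam] x) (𝓝 s) :=
    isCompact_Icc.tendsto_nhds_of_unique_mapClusterPt hIcc fun s' _ hs' =>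
      (IsCriticalPair.of_mapClusterPt hs').unique ha hb hr hpair
  refine ⟨s, ((Complex.continuous_ofReal.tendsto s).comp hlim).congr fun y => ?_, hpair⟩
  exact (S1_eq_ofReal lam y).symm

end Limit

section Generic

theorem mem_closure_of_eventually_graph {X Y : Type*} [TopologicalSpace X] [TopologicalSpace Y]
    {φ : X → Y} {s : X} [(𝓝[≠] s).NeBot] {S : Set (X × Y)} (hφ : ContinuousAt φ s)
    (h : ∀ᶠ t in 𝓝[≠] s, (t, φ t) ∈ S) : (s, φ s) ∈ closure S :=
  mem_closure_of_tendsto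
    ((continuousAt_id.prodMk hφ).tendsto.mono_left nhdsWithin_le_nhds) h

theorem eventually_eval_ne_zero {R : Type*} [CommRing R] [IsDomain R] [TopologicalSpace R]
    [T1Space R] {P : Polynomial R} (hP : P ≠ 0) (s : R) : ∀ᶠ t in 𝓝[≠] s, P.eval t ≠ 0 := by
  have hroots := mem_codiscrete.1 (Polynomial.finite_setOfPred_isRoot hP).compl_mem_codiscrete s
  rwa [compl_compl, Filter.disjoint_principal_right] at hroots

theorem hasDerivAt_div_pow {𝕜 : Type*} [NontriviallyNormedField 𝕜] (c : 𝕜) (n : ℕ) {t : 𝕜}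
    (ht : t ≠ 0) : HasDerivAt (fun u => c / u ^ n) (-(n * c) / t ^ (n + 1)) t := by
  have hpow (u : 𝕜) : c / u ^ n = c * u ^ (-n : ℤ) := by
    rw [zpow_neg, zpow_natCast, div_eq_mul_inv]
  have hexp : (-n - 1 : ℤ) = -((n + 1 : ℕ) : ℤ) := by
    push_cast
    ring
  simp only [hpow]
  refine ((hasDerivAt_zpow (-n : ℤ) t (Or.inl ht)).const_mul c).congr_deriv ?_
  rw [hexp, zpow_neg, zpow_natCast]
  push_cast
  field_simp

theorem linearIndependent_pair_prod_iff {k : Type*} [Field k] (u v : k × k) :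
    LinearIndependent k ![u, v] ↔ u.1 * v.2 - u.2 * v.1 ≠ 0 := by
  have hrow : (LinearEquiv.finTwoArrow k k).symm ∘ ![u, v] =
      Matrix.row !![u.1, u.2; v.1, v.2] := by
    ext i j
    fin_cases i <;> fin_cases j <;> rfl
  rw [← LinearMap.linearIndependent_iff
    ((LinearEquiv.finTwoArrow k k).symm : k × k →ₗ[k] Fin 2 → k) (LinearEquiv.ker _),
    LinearEquiv.coe_coe, hrow, Matrix.linearIndependent_rows_iff_isUnit,
    Matrix.isUnit_iff_isUnit_det, isUnit_iff_ne_zero, Matrix.det_fin_two_of]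

end Generic

section CuspidalEdge

variable (a b lam : ℝ) {s h : ℝ}

/-- The derivative in `s` of the coordinate `k` on `Π₁`. -/
def slope1 (h s : ℝ) : ℝ :=
  6 * s - 4 * (h - lam ^ 2 / 2) + (pSq a b ^ 2 - rSq a b ^ 2) / (2 * s ^ 3)

/-- The second derivative in `s` of the coordinate `k` on `Π₁`. -/
def curv1 (s : ℝ) : ℝ := 6 - 3 * (pSq a b ^ 2 - rSq a b ^ 2) / (2 * s ^ 4)

/-- The value of `h` at which `cuspFactor` vanishes for given `s`. -/
def cuspHeight (s : ℝ) : ℝ :=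
  lam ^ 2 / 2 + (12 * s ^ 4 + pSq a b ^ 2 - rSq a b ^ 2) / (8 * s ^ 3)

theorem cuspFactor_eq_zero_iff (hs : s ≠ 0) :
    cuspFactor a b lam s h = 0 ↔ h = cuspHeight a b lam s := by
  rw [cuspFactor, cuspHeight, ← sub_eq_iff_eq_add', eq_div_iff (by positivity)]
  constructor <;> intro h <;> linear_combination -h

theorem slope1_eq_zero_iff (hs : s ≠ 0) :
    slope1 a b lam h s = 0 ↔ cuspFactor a b lam s h = 0 := by
  have hslope : slope1 a b lam h s = cuspFactor a b lam s h / (2 * s ^ 3) := by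
    rw [slope1, cuspFactor]
    field_simp
    ring
  rw [hslope, div_eq_zero_iff, or_iff_left (by positivity)]

theorem hasDerivAt_section (h : ℝ) (hs : s ≠ 0) :
    HasDerivAt (fun u => (surf1 a b lam (u, h)).2)
      (slope1 a b lam h s, -(s / 2) * slope1 a b lam h s) s := by
  have hid := hasDerivAt_id' s
  have h₂ := hasDerivAt_div_pow ((pSq a b ^ 2 - rSq a b ^ 2) / 4) 2 hs
  have h₁ := hasDerivAt_div_pow ((pSq a b ^ 2 - rSq a b ^ 2) / 4) 1 hs
  have hk := (((hid.const_mul (4 * (h - lam ^ 2 / 2))).const_sub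
    (pSq a b + (h - lam ^ 2 / 2) ^ 2)).fun_add ((hid.fun_pow 2).const_mul 3)).fun_sub h₂
  have hg := ((hid.const_sub (h - lam ^ 2 / 2)).fun_mul (hid.fun_pow 2)).fun_add h₁
  simp only [div_div, pow_one] at hk hg
  refine (hk.prodMk hg).congr_deriv (Prod.ext ?_ ?_)
  · simp only [slope1]
    field_simp
    ring
  · simp only [slope1]
    field_simp
    ring

theorem hasDerivAt_slope1 (h : ℝ) (hs : s ≠ 0) :
    HasDerivAt (slope1 a b lam h) (curv1 a b s) s := by
  have h₃ := hasDerivAt_div_pow ((pSq a b ^ 2 - rSq a b ^ 2) / 2) 3 hs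
  have := (((hasDerivAt_id' s).const_mul 6).sub_const (4 * (h - lam ^ 2 / 2))).fun_add h₃
  simp only [div_div] at this
  refine this.congr_deriv ?_
  rw [curv1]
  push_cast
  field_simp
  ring

theorem hasDerivAt_curv1 (hs : s ≠ 0) :
    HasDerivAt (curv1 a b) (6 * (pSq a b ^ 2 - rSq a b ^ 2) / s ^ 5) s := by
  have := (hasDerivAt_div_pow (3 * (pSq a b ^ 2 - rSq a b ^ 2) / 2) 4 hs).const_sub 6
  simp only [div_div] at this
  refine this.congr_deriv ?_
  push_cast
  field_simp
  ring

theorem eventually_deriv_section (h : ℝ) (hs : s ≠ 0) :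
    deriv (fun u => (surf1 a b lam (u, h)).2) =ᶠ[𝓝 s]
      fun u => (slope1 a b lam h u, -(u / 2) * slope1 a b lam h u) := by
  filter_upwards [isOpen_ne.mem_nhds hs] with u hu using (hasDerivAt_section a b lam h hu).deriv

theorem eventually_iteratedDeriv_two_section (h : ℝ) (hs : s ≠ 0) :
    iteratedDeriv 2 (fun u => (surf1 a b lam (u, h)).2) =ᶠ[𝓝 s]
      fun u => (curv1 a b u, -(1 / 2) * slope1 a b lam h u + -(u / 2) * curv1 a b u) := by
  filter_upwards [isOpen_ne.mem_nhds hs] with u hu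
  rw [iteratedDeriv_succ, iteratedDeriv_one, (eventually_deriv_section a b lam h hu).deriv_eq]
  have hslope := hasDerivAt_slope1 a b lam h hu
  exact (hslope.prodMk (((hasDerivAt_id' u).div_const 2).fun_neg.fun_mul hslope)).deriv

theorem iteratedDeriv_three_section (h : ℝ) (hs : s ≠ 0) :
    iteratedDeriv 3 (fun u => (surf1 a b lam (u, h)).2) s =
      (6 * (pSq a b ^ 2 - rSq a b ^ 2) / s ^ 5,
        -curv1 a b s - s / 2 * (6 * (pSq a b ^ 2 - rSq a b ^ 2) / s ^ 5)) := by
  rw [iteratedDeriv_succ, (eventually_iteratedDeriv_two_section a b lam h hs).deriv_eq]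
  have hcurv := hasDerivAt_curv1 a b hs
  refine (hcurv.prodMk (((hasDerivAt_slope1 a b lam h hs).const_mul (-(1 / 2))).fun_add
    (((hasDerivAt_id' s).div_const 2).fun_neg.fun_mul hcurv))).deriv.trans
      (Prod.ext rfl ?_)
  simp only
  ring

theorem hasCusp_iff (h : ℝ) (hs : s ≠ 0) :
    HasCusp (fun u => (surf1 a b lam (u, h)).2) s ↔
      cuspFactor a b lam s h = 0 ∧ curv1 a b s ≠ 0 := by
  rw [HasCusp, (hasDerivAt_section a b lam h hs).deriv, iteratedDeriv_three_section a b lam h hs,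
    (eventually_iteratedDeriv_two_section a b lam h hs).eq_of_nhds,
    linearIndependent_pair_prod_iff, ← slope1_eq_zero_iff a b lam hs, Prod.mk_eq_zero,
    and_iff_left_of_imp fun h0 => mul_eq_zero_of_right _ h0]
  refine and_congr_right fun hslope => ?_
  have hdet (d : ℝ) : curv1 a b s * (-curv1 a b s - s / 2 * d) -
      (-(1 / 2) * slope1 a b lam h s + -(s / 2) * curv1 a b s) * d = -curv1 a b s ^ 2 := by
    rw [hslope]
    ring
  rw [hdet, neg_ne_zero, pow_ne_zero_iff two_ne_zero]

theorem eventually_curv1_ne_zero (hs : s ≠ 0) : ∀ᶠ t in 𝓝[≠] s, curv1 a b t ≠ 0 := by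
  have hP : (Polynomial.X ^ 4 - Polynomial.C ((pSq a b ^ 2 - rSq a b ^ 2) / 4) :
      Polynomial ℝ) ≠ 0 := Polynomial.X_pow_sub_C_ne_zero four_pos _
  filter_upwards [eventually_eval_ne_zero hP s,
    eventually_ne_nhdsWithin hs] with t heval ht hcurv
  rw [curv1, sub_eq_zero, eq_div_iff (by positivity)] at hcurv
  refine heval ?_
  rw [Polynomial.eval_sub, Polynomial.eval_pow, Polynomial.eval_X, Polynomial.eval_C]
  linear_combination hcurv / 12

theorem mem_cuspidalEdge1_iff (hs : s ≠ 0) :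
    (s, h) ∈ cuspidalEdge1 a b lam ↔ cuspFactor a b lam s h = 0 := by
  constructor
  · have hclosed : IsClosed {q : ℝ × ℝ | cuspFactor a b lam q.1 q.2 = 0} :=
      isClosed_eq (by unfold cuspFactor; fun_prop) continuous_const
    refine fun hq => hclosed.closure_subset_iff.2 ?_ hq
    rintro ⟨t, k⟩ ⟨ht, hcusp⟩
    exact ((hasCusp_iff a b lam k ht).1 hcusp).1
  · rw [cuspFactor_eq_zero_iff a b lam hs]
    rintro rfl
    have hcont : ContinuousAt (cuspHeight a b lam) s :=
      continuousAt_const.add (ContinuousAt.div (by fun_prop) (by fun_prop) (by positivity))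
    refine mem_closure_of_eventually_graph hcont ?_
    filter_upwards [eventually_curv1_ne_zero a b hs,
      eventually_ne_nhdsWithin hs] with t hcurv ht
    exact ⟨ht, (hasCusp_iff a b lam _ ht).2 ⟨(cuspFactor_eq_zero_iff a b lam ht).2 rfl, hcurv⟩⟩

end CuspidalEdge

section TangentPlanes

variable {s κ m n s' κ' m' n' : ℝ}

/-- The linear map `(u, v) ↦ (v, κ u + m v, -(s / 2) κ u + n v)`; the differentials of the
parametrizations of both `Π₁` and `Π₂` at a point with first parameter `s` have this form. -/
def surfDiff (s κ m n : ℝ) : ℝ × ℝ →L[ℝ] ℝ × ℝ × ℝ :=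
  (ContinuousLinearMap.snd ℝ ℝ ℝ).prod
    ((κ • ContinuousLinearMap.fst ℝ ℝ ℝ + m • ContinuousLinearMap.snd ℝ ℝ ℝ).prod
      ((-(s / 2) * κ) • ContinuousLinearMap.fst ℝ ℝ ℝ + n • ContinuousLinearMap.snd ℝ ℝ ℝ))

theorem surfDiff_apply (s κ m n : ℝ) (v : ℝ × ℝ) :
    surfDiff s κ m n v = (v.2, κ * v.1 + m * v.2, -(s / 2) * κ * v.1 + n * v.2) := rfl

theorem injective_surfDiff_iff : Function.Injective (surfDiff s κ m n) ↔ κ ≠ 0 := by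
  rw [injective_iff_map_eq_zero]
  constructor
  · rintro hinj rfl
    have h := hinj (1, 0) (by simp only [surfDiff_apply, zero_mul, mul_zero, add_zero]; rfl)
    exact one_ne_zero (congrArg Prod.fst h)
  · intro hκ v hv
    rw [surfDiff_apply, Prod.mk_eq_zero, Prod.mk_eq_zero] at hv
    obtain ⟨h₂, h₁, -⟩ := hv
    rw [h₂, mul_zero, add_zero] at h₁
    exact Prod.ext ((mul_eq_zero.1 h₁).resolve_left hκ) h₂

theorem mem_range_surfDiff_iff (hκ : κ ≠ 0) (w : ℝ × ℝ × ℝ) :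
    w ∈ LinearMap.range (surfDiff s κ m n : ℝ × ℝ →ₗ[ℝ] ℝ × ℝ × ℝ) ↔
      2 * w.2.2 + s * w.2.1 = (2 * n + s * m) * w.1 := by
  constructor
  · rintro ⟨v, rfl⟩
    simp only [ContinuousLinearMap.coe_coe, surfDiff_apply]
    ring
  · intro h
    refine ⟨((w.2.1 - m * w.1) / κ, w.1), Prod.ext rfl (Prod.ext ?_ ?_)⟩
    · simp only [ContinuousLinearMap.coe_coe, surfDiff_apply]
      field_simp
      ring
    · simp only [ContinuousLinearMap.coe_coe, surfDiff_apply]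
      field_simp
      linear_combination -h

theorem range_surfDiff_eq_iff (hκ : κ ≠ 0) (hκ' : κ' ≠ 0) :
    LinearMap.range (surfDiff s κ m n : ℝ × ℝ →ₗ[ℝ] ℝ × ℝ × ℝ) =
        LinearMap.range (surfDiff s' κ' m' n' : ℝ × ℝ →ₗ[ℝ] ℝ × ℝ × ℝ) ↔
      s = s' ∧ 2 * n + s * m = 2 * n' + s' * m' := by
  simp only [Submodule.ext_iff, mem_range_surfDiff_iff hκ, mem_range_surfDiff_iff hκ']
  constructor
  · intro h
    have hs := (h (0, 1, -(s / 2))).1 (by ring)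
    have hn := (h (1, 0, n + s * m / 2)).1 (by ring)
    simp only at hs hn
    exact ⟨by linarith, by linarith⟩
  · rintro ⟨rfl, h⟩ w
    rw [h]

end TangentPlanes

section TangencyCurve

variable (a b lam : ℝ) {s h : ℝ}

/-- The derivative in `s` of the coordinate `k` on `Π₂`. -/
def slope2 (s : ℝ) : ℝ := 4 * lam ^ 2 - rSq a b ^ 2 / (2 * s ^ 3)

/-- The value of `h` at which `tangencyFactor` vanishes for given `s`. -/
def tangencyHeight (s : ℝ) : ℝ := s + pSq a b / (2 * s) - lam ^ 2 / 2

theorem tangencyFactor_eq_zero_iff (hs : s ≠ 0) :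
    tangencyFactor a b lam s h = 0 ↔ h = tangencyHeight a b lam s := by
  rw [tangencyFactor, tangencyHeight, eq_sub_iff_add_eq, ← sub_eq_iff_eq_add',
    eq_div_iff (mul_ne_zero two_ne_zero hs)]
  constructor <;> intro h <;> linear_combination -h

theorem hasFDerivAt_surf1 (h : ℝ) (hs : s ≠ 0) :
    HasFDerivAt (surf1 a b lam) (surfDiff s (slope1 a b lam h s)
      (2 * (h - lam ^ 2 / 2) - 4 * s) (s ^ 2)) (s, h) := by
  have hfst := hasFDerivAt_fst (𝕜 := ℝ) (p := (s, h))
  have hsnd := hasFDerivAt_snd (𝕜 := ℝ) (p := (s, h))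
  have hsub := hsnd.sub_const (lam ^ 2 / 2)
  have h₂ := (hasDerivAt_div_pow ((pSq a b ^ 2 - rSq a b ^ 2) / 4) 2 hs).comp_hasFDerivAt (s, h)
    hfst
  have h₁ := (hasDerivAt_div_pow ((pSq a b ^ 2 - rSq a b ^ 2) / 4) 1 hs).comp_hasFDerivAt (s, h)
    hfst
  have hk := ((((hsub.pow 2).const_add (pSq a b)).fun_sub
    ((hsub.const_mul 4).fun_mul hfst)).fun_add ((hfst.pow 2).const_mul 3)).fun_sub h₂
  have hg := ((hsub.fun_sub hfst).fun_mul (hfst.pow 2)).fun_add h₁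
  simp only [Function.comp_def, div_div, pow_one] at hk hg
  refine (hsnd.prodMk (hk.prodMk hg)).congr_fderiv (ContinuousLinearMap.ext fun v => ?_)
  rw [surfDiff_apply]
  refine Prod.ext rfl (Prod.ext ?_ ?_)
  · simp only [slope1, Nat.add_one_sub_one, pow_one, nsmul_eq_mul, Nat.cast_ofNat, Nat.cast_one,
      one_mul, ContinuousLinearMap.prod_apply, ContinuousLinearMap.coe_fst',
      ContinuousLinearMap.coe_snd', add_apply, sub_apply, smul_apply, smul_eq_mul]
    field_simp
    ring
  · simp only [slope1, Nat.add_one_sub_one, pow_one, nsmul_eq_mul, Nat.cast_ofNat, Nat.cast_one,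
      one_mul, ContinuousLinearMap.prod_apply, ContinuousLinearMap.coe_fst',
      ContinuousLinearMap.coe_snd', add_apply, sub_apply, smul_apply, smul_eq_mul]
    field_simp
    ring

theorem hasFDerivAt_surf2 (h : ℝ) (hs : s ≠ 0) :
    HasFDerivAt (surf2 a b lam) (surfDiff s (slope2 a b lam s) (-2 * lam ^ 2) (pSq a b / 2))
      (s, h) := by
  have hfst := hasFDerivAt_fst (𝕜 := ℝ) (p := (s, h))
  have hsnd := hasFDerivAt_snd (𝕜 := ℝ) (p := (s, h))
  have h₂ := (hasDerivAt_div_pow (rSq a b ^ 2 / 4) 2 hs).comp_hasFDerivAt (s, h) hfst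
  have h₁ := (hasDerivAt_div_pow (rSq a b ^ 2 / 4) 1 hs).comp_hasFDerivAt (s, h) hfst
  have hk := ((((hsnd.sub_const (lam ^ 2 / 2)).fun_sub (hfst.const_mul 2)).const_mul
    (-2 * lam ^ 2)).sub_const (lam ^ 4)).fun_add h₂
  have hg := ((((hsnd.add_const (lam ^ 2 / 2)).const_mul (pSq a b)).mul_const 2⁻¹).fun_sub
    ((hfst.pow 2).const_mul (lam ^ 2))).fun_sub h₁
  simp only [Function.comp_def, div_div, pow_one, ← div_eq_mul_inv] at hk hg
  refine (hsnd.prodMk (hk.prodMk hg)).congr_fderiv (ContinuousLinearMap.ext fun v => ?_)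
  rw [surfDiff_apply]
  refine Prod.ext rfl (Prod.ext ?_ ?_)
  · simp only [slope2, Nat.add_one_sub_one, pow_one, nsmul_eq_mul, Nat.cast_ofNat, Nat.cast_one,
      one_mul, ContinuousLinearMap.prod_apply, ContinuousLinearMap.coe_fst',
      ContinuousLinearMap.coe_snd', add_apply, sub_apply, smul_apply, smul_eq_mul]
    field_simp
    ring
  · simp only [slope2, Nat.add_one_sub_one, pow_one, nsmul_eq_mul, Nat.cast_ofNat, Nat.cast_one,
      one_mul, ContinuousLinearMap.prod_apply, ContinuousLinearMap.coe_fst',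
      ContinuousLinearMap.coe_snd', add_apply, sub_apply, smul_apply, smul_eq_mul]
    field_simp
    ring

theorem surf2_eq_surf1 (hs : s ≠ 0) :
    surf2 a b lam (s, tangencyHeight a b lam s) = surf1 a b lam (s, tangencyHeight a b lam s) := by
  refine Prod.ext rfl (Prod.ext ?_ ?_)
  · simp only [surf1, surf2, tangencyHeight]
    field_simp
    ring
  · simp only [surf1, surf2, tangencyHeight]
    field_simp
    ring

theorem tangencyFactor_eq_zero_of_range_eq {q q' : ℝ × ℝ} (hq : q.1 ≠ 0) (hq' : q'.1 ≠ 0)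
    (hinj : Function.Injective (fderiv ℝ (surf1 a b lam) q))
    (hinj' : Function.Injective (fderiv ℝ (surf2 a b lam) q'))
    (hrange : LinearMap.range (fderiv ℝ (surf1 a b lam) q : ℝ × ℝ →ₗ[ℝ] ℝ × ℝ × ℝ) =
      LinearMap.range (fderiv ℝ (surf2 a b lam) q' : ℝ × ℝ →ₗ[ℝ] ℝ × ℝ × ℝ)) :
    tangencyFactor a b lam q.1 q.2 = 0 := by
  rw [(hasFDerivAt_surf1 a b lam q.2 hq).fderiv] at hinj hrange
  rw [(hasFDerivAt_surf2 a b lam q'.2 hq').fderiv] at hinj' hrange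
  obtain ⟨hs, hplane⟩ := (range_surfDiff_eq_iff (injective_surfDiff_iff.1 hinj)
    (injective_surfDiff_iff.1 hinj')).1 hrange
  rw [← hs] at hplane
  rw [tangencyFactor]
  linear_combination -hplane

theorem range_fderiv_surf1_eq_range_fderiv_surf2 (hs : s ≠ 0)
    (h₁ : slope1 a b lam (tangencyHeight a b lam s) s ≠ 0) (h₂ : slope2 a b lam s ≠ 0) :
    LinearMap.range (fderiv ℝ (surf1 a b lam) (s, tangencyHeight a b lam s) :
        ℝ × ℝ →ₗ[ℝ] ℝ × ℝ × ℝ) =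
      LinearMap.range (fderiv ℝ (surf2 a b lam) (s, tangencyHeight a b lam s) :
        ℝ × ℝ →ₗ[ℝ] ℝ × ℝ × ℝ) := by
  rw [(hasFDerivAt_surf1 a b lam _ hs).fderiv, (hasFDerivAt_surf2 a b lam _ hs).fderiv,
    range_surfDiff_eq_iff h₁ h₂]
  refine ⟨rfl, ?_⟩
  rw [tangencyHeight]
  field_simp
  ring

variable {a b}

theorem eventually_slope1_tangencyHeight_ne_zero (hpr : pSq a b ^ 2 - rSq a b ^ 2 ≠ 0)
    (hs : s ≠ 0) : ∀ᶠ t in 𝓝[≠] s, slope1 a b lam (tangencyHeight a b lam t) t ≠ 0 := by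
  open Polynomial in
  let P : ℝ[X] := C 4 * X ^ 4 + C (8 * lam ^ 2) * X ^ 3 - C (4 * pSq a b) * X ^ 2
    + C (pSq a b ^ 2 - rSq a b ^ 2)
  have hP (t : ℝ) : P.eval t = 4 * t ^ 4 + 8 * lam ^ 2 * t ^ 3 - 4 * pSq a b * t ^ 2
      + (pSq a b ^ 2 - rSq a b ^ 2) := by
    simp only [P, Polynomial.eval_add, Polynomial.eval_sub, Polynomial.eval_mul,
      Polynomial.eval_pow, Polynomial.eval_X, Polynomial.eval_C]
  have hP0 : P ≠ 0 := fun h => hpr (by simpa [h] using (hP 0).symm)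
  filter_upwards [eventually_eval_ne_zero hP0 s, eventually_ne_nhdsWithin hs] with t heval ht hslope
  rw [slope1_eq_zero_iff a b lam ht, cuspFactor] at hslope
  refine heval ?_
  rw [hP, ← hslope, tangencyHeight]
  field_simp
  ring

theorem eventually_slope2_ne_zero (hr : rSq a b ≠ 0) (hs : s ≠ 0) :
    ∀ᶠ t in 𝓝[≠] s, slope2 a b lam t ≠ 0 := by
  open Polynomial in
  let P : ℝ[X] := C (8 * lam ^ 2) * X ^ 3 - C (rSq a b ^ 2)
  have hP (t : ℝ) : P.eval t = 8 * lam ^ 2 * t ^ 3 - rSq a b ^ 2 := by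
    simp only [P, Polynomial.eval_sub, Polynomial.eval_mul, Polynomial.eval_pow, Polynomial.eval_X,
      Polynomial.eval_C]
  have hP0 : P ≠ 0 := fun h => hr (by simpa [h] using (hP 0).symm)
  filter_upwards [eventually_eval_ne_zero hP0 s, eventually_ne_nhdsWithin hs] with t heval ht hslope
  rw [slope2, sub_eq_zero, eq_div_iff (by positivity)] at hslope
  refine heval ?_
  rw [hP]
  linear_combination hslope

theorem mem_tangencyCurve_iff (hpr : pSq a b ^ 2 - rSq a b ^ 2 ≠ 0) (hr : rSq a b ≠ 0)
    (hs : s ≠ 0) : (s, h) ∈ tangencyCurve a b lam ↔ tangencyFactor a b lam s h = 0 := by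
  constructor
  · have hclosed : IsClosed {q : ℝ × ℝ | tangencyFactor a b lam q.1 q.2 = 0} :=
      isClosed_eq (by unfold tangencyFactor; fun_prop) continuous_const
    refine fun hq => hclosed.closure_subset_iff.2 ?_ hq
    rintro q ⟨hq, q', hq', -, hinj, hinj', hrange⟩
    exact tangencyFactor_eq_zero_of_range_eq a b lam hq hq' hinj hinj' hrange
  · rw [tangencyFactor_eq_zero_iff a b lam hs]
    rintro rfl
    have hcont : ContinuousAt (tangencyHeight a b lam) s :=
      (continuousAt_id.add (continuousAt_const.div (by fun_prop)
        (mul_ne_zero two_ne_zero hs))).sub continuousAt_const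
    refine mem_closure_of_eventually_graph hcont ?_
    filter_upwards [eventually_slope1_tangencyHeight_ne_zero lam hpr hs,
      eventually_slope2_ne_zero lam hr hs, eventually_ne_nhdsWithin hs] with t h₁ h₂ ht
    refine ⟨ht, _, ht, surf2_eq_surf1 a b lam ht, ?_, ?_,
      range_fderiv_surf1_eq_range_fderiv_surf2 a b lam ht h₁ h₂⟩
    · rwa [(hasFDerivAt_surf1 a b lam _ ht).fderiv, injective_surfDiff_iff]
    · rwa [(hasFDerivAt_surf2 a b lam _ ht).fderiv, injective_surfDiff_iff]

theorem muSq_eq_zero_iff (ha : a ≠ 0) (hb : b ≠ 0) (hr : rSq a b ≠ 0) (hs : s ≠ 0) :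
    muSq a b lam s h = 0 ↔ (s, h) ∈ cuspidalEdge1 a b lam ∪ tangencyCurve a b lam := by
  have hpr : pSq a b ^ 2 - rSq a b ^ 2 ≠ 0 := by
    have h : pSq a b ^ 2 - rSq a b ^ 2 = (2 * a * b) ^ 2 := by
      rw [pSq, rSq]
      ring
    rw [h]
    positivity
  rw [muSq_eq, div_eq_zero_iff, or_iff_left (mul_ne_zero two_ne_zero hs), mul_eq_zero,
    Set.mem_union, mem_cuspidalEdge1_iff a b lam hs, mem_tangencyCurve_iff lam hpr hr hs]

end TangencyCurve

end KowalevskiGyrostat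

end

theorem mainTheorem1 (a b lam : ℝ) (hb : 0 < b) (hab : b < a) :
    (∀ x ∈ KowalevskiGyrostat.M1 a b lam, KowalevskiGyrostat.rank a b lam x = 2 →
      ∃ s : ℝ, s ≠ 0 ∧ KowalevskiGyrostat.IsS1Value a b lam x s ∧
        KowalevskiGyrostat.J a b lam x =
          KowalevskiGyrostat.surf1 a b lam (s, KowalevskiGyrostat.H x) ∧
        (∃ cH cK : ℝ, KowalevskiGyrostat.HasSquaredExponent lam
          (KowalevskiGyrostat.integral a b lam cH cK 2) x
          (KowalevskiGyrostat.muSq a b lam s (KowalevskiGyrostat.H x))) ∧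
        (KowalevskiGyrostat.IsCenter a b lam x ↔
          KowalevskiGyrostat.muSq a b lam s (KowalevskiGyrostat.H x) < 0) ∧
        (KowalevskiGyrostat.IsSaddle a b lam x ↔
          0 < KowalevskiGyrostat.muSq a b lam s (KowalevskiGyrostat.H x)) ∧
        (KowalevskiGyrostat.IsDegenerate a b lam x ↔
          KowalevskiGyrostat.muSq a b lam s (KowalevskiGyrostat.H x) = 0) ∧
        (KowalevskiGyrostat.IsDegenerate a b lam x ↔
          (s, KowalevskiGyrostat.H x) ∈ KowalevskiGyrostat.cuspidalEdge1 a b lam ∪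
            KowalevskiGyrostat.tangencyCurve a b lam)) ∧
    (∀ s h : ℝ, s ≠ 0 →
      (KowalevskiGyrostat.muSq a b lam s h = 0 ↔
        (s, h) ∈ KowalevskiGyrostat.cuspidalEdge1 a b lam ∪
          KowalevskiGyrostat.tangencyCurve a b lam)) := by
  have ha : a ≠ 0 := (hb.trans hab).ne'
  have hr : KowalevskiGyrostat.rSq a b ≠ 0 :=
    (sub_pos.2 (pow_lt_pow_left₀ hab hb.le two_ne_zero)).ne'
  have hzero {s h : ℝ} (hs : s ≠ 0) :=
    KowalevskiGyrostat.muSq_eq_zero_iff lam (h := h) ha hb.ne' hr hs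
  refine ⟨fun x hmem hrank => ?_, fun s h hs => hzero hs⟩
  obtain ⟨s, hlim, hx⟩ := KowalevskiGyrostat.exists_isS1Value ha hb.ne' hrank hmem
  have hs := hx.ne_zero ha hb.ne'
  have hdegenerate := hx.isDegenerate_iff ha hb.ne' hrank
  exact ⟨s, hs, hlim, hx.J_eq_surf1 hs,
    ⟨_, _, hx.hasSquaredExponent_criticalIntegral ha hb.ne' hrank⟩,
    hx.isCenter_iff ha hb.ne' hrank, hx.isSaddle_iff ha hb.ne' hrank, hdegenerate,
    hdegenerate.trans (hzero hs)⟩
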